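/- Let $p\ge 5$ be a prime. For $m,n\ge 1$ let $K_{m[n]}$ be the complete multipartite graph with $m$ parts of $n$ vertices each. Fix a generator $t$ of $\mathbb{Z}_p^*$ and, writing $u^v=v^{-1}uv$ and $[u,v]=u^{-1}v^{-1}uv$, let $$G_2(p)=\langle w,z,c,g\mid w^p=z^p=c^p=g^{p-1}=1,\ [w,z]=1,\ c^g=c^t,\ w^c=wz,\ z^c=z,\ w^g=w,\ z^g=z^t\rangle .$$ For a group $G$ generated by an element $a$ and an involution $b$, with $\langle a\rangle$ core-free, let $\mathcal{M}(G;a,b)$ be the algebraic map whose vertices are the right cosets $\langle a\rangle x$ $(x\in G)$, whose arcs are the pairs $(\langle a\rangle x,\langle a\rangle bx)$, and whose local rotation sends $(\langle a\rangle x,\langle a\rangle bx)$ to $(\langle a\rangle x,\langle a\rangle bax)$. For $j\in\mathbb{Z}_{p-1}^*$ put $$\mathcal{M}_2(p,j)=\mathcal{M}\bigl(G_2(p);\,wg^j,\,cg^{(p-1)/2}\bigr).$$ Isomorphisms of maps are orientation-preserving. **(1)** Let $e\ge 1$ and let $\mathcal{M}$ be an orientably-regular embedding of $K_{p[p^e]}$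 (the group $G=\mathrm{Aut}^+(\mathcal{M})$ of all orientation-preserving automorphisms acts regularly on the arcs). Let $H$ be the subgroup of $G$ consisting of the automorphisms that preserve each part setwise, and let $P$ be a Sylow $p$-subgroup of $G$. If $H$ is abelian and the exponent of $P$ is $p^e$, then $e=1$ and there is exactly one $j\in\mathbb{Z}_{p-1}^*$ such that $\mathcal{M}$ is isomorphic to $\mathcal{M}_2(p,j)$. **(2)** If $j_1,j_2\in\mathbb{Z}_{p-1}^*$ and $\mathcal{M}_2(p,j_1)\cong\mathcal{M}_2(p,j_2)$, then $j_1=j_2$. **(3)** For every $j\in\mathbb{Z}_{p-1}^*$ the map $\mathcal{M}_2(p,j)$ is an orientably-regular embedding of $K_{p[p]}$; it is chiral (it has no orientation-reversing automorphism); and it has type $\{p(p-1),p(p-1)\}$ if $p\equiv 1\pmod 4$ and type $\{p(p-1)/2,\,p(p-1)\}$ if $p\equiv 3\pmod 4$, where type $\{s,r\}$ means that all faces are $s$-gons and all vertices have valency $r$. -/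

import Mathlib

/-- The combinatorial data of a map on an oriented closed surface: a set `D` of arcs (edges with a
direction), the local rotation `rot`, which sends an arc to the next arc with the same initial
vertex in the positive sense, and the arc reversal `rev`.  Vertices, edges and faces are the orbits
of `rot`, of `rev` and of `rot * rev`. -/
structure ArcMap (D : Type*) where
  rot : Equiv.Perm D
  rev : Equiv.Perm D

namespace ArcMap

/-- Orientation-preserving isomorphism of maps. -/
def Isomorphic {D D' : Type*} (M : ArcMap D) (N : ArcMap D') : Prop :=
  ∃ f : D ≃ D', (∀ d, f (M.rot d) = N.rot (f d)) ∧ (∀ d, f (M.rev d) = N.rev (f d))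

/-- The same map on the surface with the opposite orientation. -/
def mirror {D : Type*} (M : ArcMap D) : ArcMap D where
  rot := M.rot⁻¹
  rev := M.rev

/-- A map is reflexible if it has an orientation-reversing automorphism. -/
def Reflexible {D : Type*} (M : ArcMap D) : Prop := M.Isomorphic M.mirror

/-- A map is chiral if it has no orientation-reversing automorphism. (The term is used for
orientably-regular maps only.) -/
def Chiral {D : Type*} (M : ArcMap D) : Prop := ¬ M.Reflexible

/-- The permutation whose orbits are the boundaries of the faces: run along an arc to its
end and take the next arc there. -/
def facePerm {D : Type*} (M : ArcMap D) : Equiv.Perm D := M.rot * M.rev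

/-- Type `{s, t}`: all faces are `s`-gons and all vertices have valency `t`. -/
def HasType {D : Type*} (M : ArcMap D) (s t : ℕ) : Prop :=
  (∀ d, Nat.card {d' : D // M.facePerm.SameCycle d d'} = s) ∧
  (∀ d, Nat.card {d' : D // M.rot.SameCycle d d'} = t)

end ArcMap

/-- A 2-cell embedding of a connected simple graph `Γ` into an oriented closed surface, given as
a rotation system: a permutation of the arcs of `Γ` that permutes cyclically the arcs starting at
each vertex. -/
structure OrientedEmbedding {V : Type*} (Γ : SimpleGraph V) where
  connected : Γ.Connected
  rotation : Equiv.Perm Γ.Dart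
  fst_rotation : ∀ d, (rotation d).fst = d.fst
  sameCycle : ∀ d d' : Γ.Dart, d.fst = d'.fst → rotation.SameCycle d d'

namespace OrientedEmbedding

variable {V : Type*} {Γ : SimpleGraph V}

/-- The map defined by an embedding. -/
def toArcMap (M : OrientedEmbedding Γ) : ArcMap Γ.Dart where
  rot := M.rotation
  rev := SimpleGraph.Dart.symm_involutive.toPerm

/-- The action of a graph automorphism on arcs. -/
def onArcs (φ : Γ ≃g Γ) (d : Γ.Dart) : Γ.Dart := φ.toHom.mapDart d

theorem onArcs_mul (φ ψ : Γ ≃g Γ) (d : Γ.Dart) : onArcs (φ * ψ) d = onArcs φ (onArcs ψ d) := rfl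

theorem onArcs_inv_cancel (φ : Γ ≃g Γ) (d : Γ.Dart) : onArcs φ⁻¹ (onArcs φ d) = d := by
  rw [← onArcs_mul, inv_mul_cancel]; rfl

theorem onArcs_cancel_inv (φ : Γ ≃g Γ) (d : Γ.Dart) : onArcs φ (onArcs φ⁻¹ d) = d := by
  rw [← onArcs_mul, mul_inv_cancel]; rfl

/-- The group of all orientation-preserving automorphisms of the map: the automorphisms of the
underlying graph that preserve the rotation. -/
def autPlus (M : OrientedEmbedding Γ) : Subgroup (Γ ≃g Γ) where
  carrier := {φ | ∀ d, onArcs φ (M.rotation d) = M.rotation (onArcs φ d)}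
  one_mem' := fun _ => rfl
  mul_mem' := by
    intro φ ψ hφ hψ d
    rw [onArcs_mul, onArcs_mul, hψ d, hφ]
  inv_mem' := by
    intro φ hφ d
    have h := hφ (onArcs φ⁻¹ d)
    rw [onArcs_cancel_inv] at h
    rw [← h, onArcs_inv_cancel]

/-- The group of orientation-preserving automorphisms acts regularly on the arcs. -/
def IsOrientablyRegular (M : OrientedEmbedding Γ) : Prop :=
  ∀ d d' : Γ.Dart, ∃! φ : M.autPlus, onArcs (φ : Γ ≃g Γ) d = d'

end OrientedEmbedding

/-- For an embedding of the complete multipartite graph with `m` parts `{i} × Fin n`, the subgroup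
of the orientation-preserving automorphisms that preserve each part setwise. -/
def autPlusZero {m n : ℕ} (M : OrientedEmbedding (SimpleGraph.completeEquipartiteGraph m n)) :
    Subgroup M.autPlus where
  carrier := {φ | ∀ v : Fin m × Fin n,
    ((φ : SimpleGraph.completeEquipartiteGraph m n ≃g
      SimpleGraph.completeEquipartiteGraph m n) v).1 = v.1}
  one_mem' := fun _ => rfl
  mul_mem' := by
    intro φ ψ hφ hψ v
    exact (hφ _).trans (hψ v)
  inv_mem' := by
    intro φ hφ v
    have h := hφ ((φ⁻¹ : M.autPlus).1 v)
    have h2 : φ.1 ((φ⁻¹ : M.autPlus).1 v) = v := RelIso.apply_symm_apply φ.1 v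
    rw [h2] at h
    exact h.symm

/-- The algebraic map of a group `G` generated by `a` and an involution `b`. The vertices are the
right cosets of `⟨a⟩`; `G` acts regularly by right multiplication on the arcs `(⟨a⟩g, ⟨a⟩bg)`, and
the arc `(⟨a⟩g, ⟨a⟩bg)` is represented by `g`. Its reverse `(⟨a⟩bg, ⟨a⟩g)` is then `b * g`, and the
next arc `(⟨a⟩g, ⟨a⟩bag)` at its initial vertex is `a * g`. -/
def algebraicMap {G : Type*} [Group G] (a b : G) : ArcMap G where
  rot := Equiv.mulLeft a
  rev := Equiv.mulLeft b

/-- Names of the four generators of the group `GroupTwo p t`. -/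
inductive GenTwo where
  | w | z | c | g

/-- The defining relators, with `u ^ v = v⁻¹ * u * v` and `[w, z] = w⁻¹ * z⁻¹ * w * z`. -/
inductive RelTwo (p : ℕ) (t : (ZMod p)ˣ) : FreeGroup GenTwo → Prop
  | w_pow : RelTwo p t (FreeGroup.of .w ^ p)
  | z_pow : RelTwo p t (FreeGroup.of .z ^ p)
  | c_pow : RelTwo p t (FreeGroup.of .c ^ p)
  | g_pow : RelTwo p t (FreeGroup.of .g ^ (p - 1))
  | w_z : RelTwo p t ((FreeGroup.of .w)⁻¹ * (FreeGroup.of .z)⁻¹ * FreeGroup.of .w * FreeGroup.of .z)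
  | c_g : RelTwo p t ((FreeGroup.of .g)⁻¹ * FreeGroup.of .c * FreeGroup.of .g *
      (FreeGroup.of .c ^ (t : ZMod p).val)⁻¹)
  | w_c : RelTwo p t ((FreeGroup.of .c)⁻¹ * FreeGroup.of .w * FreeGroup.of .c *
      (FreeGroup.of .w * FreeGroup.of .z)⁻¹)
  | z_c : RelTwo p t ((FreeGroup.of .c)⁻¹ * FreeGroup.of .z * FreeGroup.of .c *
      (FreeGroup.of .z)⁻¹)
  | w_g : RelTwo p t ((FreeGroup.of .g)⁻¹ * FreeGroup.of .w * FreeGroup.of .g *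
      (FreeGroup.of .w)⁻¹)
  | z_g : RelTwo p t ((FreeGroup.of .g)⁻¹ * FreeGroup.of .z * FreeGroup.of .g *
      (FreeGroup.of .z ^ (t : ZMod p).val)⁻¹)

/-- The group `⟨w, z, c, g ∣ w^p = z^p = c^p = g^(p-1) = 1, [w, z] = 1, c^g = c^t, w^c = w z,
z^c = z, w^g = w, z^g = z^t⟩`. -/
abbrev GroupTwo (p : ℕ) (t : (ZMod p)ˣ) : Type := PresentedGroup {r | RelTwo p t r}

/-- A generator, as an element of `GroupTwo p t`. -/
def GroupTwo.gen (p : ℕ) (t : (ZMod p)ˣ) (s : GenTwo) : GroupTwo p t := PresentedGroup.of s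

/-- The map given by the group `GroupTwo p t` and its elements `w g^j` and `c g^((p-1)/2)`. -/
def mapTwo (p : ℕ) (t : (ZMod p)ˣ) (j : (ZMod (p - 1))ˣ) : ArcMap (GroupTwo p t) :=
  algebraicMap
    (GroupTwo.gen p t .w * GroupTwo.gen p t .g ^ (j : ZMod (p - 1)).val)
    (GroupTwo.gen p t .c * GroupTwo.gen p t .g ^ ((p - 1) / 2))

/-! An orientably-regular map is recorded by its group and two elements: `a` generates the
stabilizer of a vertex and the involution `b` reverses an arc there. The abstract maps and the
embeddings are therefore compared through group isomorphisms carrying one pair to the other.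

The presented group is a group of 3 by 3 matrices: there is a surjection onto `MatTwo p`, and normal
forms bound the order by the number of matrices. Under it `w g^j` becomes the matrix with `x = 1`
and `u = s`, where `s = t^j`, and `c g^((p-1)/2)` becomes `flip p`. The multiplier `s` is an
invariant of the pair (`unit_eq_of_monoidHom`). Hence different `j` give different maps. The mirror
image has multiplier `s⁻¹ ≠ s`, so the map is chiral. The type follows from the orders of `a` and `a
* b`. Labelling the vertices by the cosets of `⟨a⟩` produces the embedding.

For the classification, put `x = a^(p-1)` and `y = b x b`. When the part-preserving group `H` is
abelian, it is `⟨x⟩ × ⟨y⟩`, homocyclic of exponent `p^e`. With `γ = a^(p^e)`, the element `c = b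
γ^((p-1)/2)` lies in the normal Sylow `p`-subgroup, conjugates `x` to `y`, and `c^p` lies in `H`. So
`c` acts on `H` by a companion matrix whose `p`-th power is the identity modulo `p^e`; for `p ≥ 5`
this forces `e = 1` and the characteristic polynomial `(X - 1)^2` (`companion_pow_prime_eq_one`).
The exponent hypothesis then gives `c^p = 1`, so `H` and `c` generate a Heisenberg group. Since `γ`
has order prime to `p`, its action there can be normalized to a power map on `c`, and the defining
relations of `GroupTwo p t` hold (`exists_mulEquiv_groupTwo`). -/

namespace ArcMap

/-! ### Isomorphisms of maps. -/

theorem Isomorphic.symm {D D' : Type*} {M : ArcMap D} {N : ArcMap D'} (h : M.Isomorphic N) :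
    N.Isomorphic M := by
  obtain ⟨f, hr, hv⟩ := h
  exact ⟨f.symm, fun d => by rw [Equiv.symm_apply_eq, hr, Equiv.apply_symm_apply],
    fun d => by rw [Equiv.symm_apply_eq, hv, Equiv.apply_symm_apply]⟩

theorem Isomorphic.trans {D D' D'' : Type*} {M : ArcMap D} {N : ArcMap D'} {L : ArcMap D''}
    (h : M.Isomorphic N) (h' : N.Isomorphic L) : M.Isomorphic L := by
  obtain ⟨f, hr, hv⟩ := h
  obtain ⟨f', hr', hv'⟩ := h'
  exact ⟨f.trans f', fun d => by simp [hr, hr'], fun d => by simp [hv, hv']⟩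

theorem Isomorphic.mirror {D D' : Type*} {M : ArcMap D} {N : ArcMap D'} (h : M.Isomorphic N) :
    M.mirror.Isomorphic N.mirror := by
  obtain ⟨f, hr, hv⟩ := h
  refine ⟨f, fun d => ?_, hv⟩
  change f (M.rot⁻¹ d) = N.rot⁻¹ (f d)
  rw [Equiv.Perm.eq_inv_iff_eq, ← hr]
  simp

end ArcMap

/-! ### Algebraic maps: isomorphisms, mirror image and type in terms of the group. -/

section AlgebraicMap

variable {G G' : Type*} [Group G] [Group G']

theorem algebraicMap_isomorphic_map (e : G ≃* G') (a b : G) :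
    (algebraicMap a b).Isomorphic (algebraicMap (e a) (e b)) :=
  ⟨e.toEquiv, fun d => e.map_mul a d, fun d => e.map_mul b d⟩

theorem algebraicMap_mirror (a b : G) : (algebraicMap a b).mirror = algebraicMap a⁻¹ b := by
  unfold ArcMap.mirror algebraicMap
  congr 1
  exact (map_inv (MulAction.toPermHom G G) a).symm

/-- An isomorphism between algebraic maps is, up to a translation, a group homomorphism that maps
the distinguished generators to the distinguished generators. -/
theorem exists_monoidHom_of_isomorphic {a b : G} {a' b' : G'}
    (hgen : Subgroup.closure {a, b} = ⊤)
    (h : (algebraicMap a b).Isomorphic (algebraicMap a' b')) :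
    ∃ σ : G →* G', σ a = a' ∧ σ b = b' := by
  obtain ⟨f, hr, hv⟩ := h
  change ∀ d, f (a * d) = a' * f d at hr
  change ∀ d, f (b * d) = b' * f d at hv
  -- Right translations are automorphisms of the target map, so the image of the identity may be
  -- moved to the identity.
  obtain ⟨F, hF⟩ : ∃ F : G → G', ∀ x, F x = f x * (f 1)⁻¹ := ⟨_, fun _ => rfl⟩
  have hFa : ∀ x, F (a * x) = a' * F x := fun x => by simp [hF, hr, mul_assoc]
  have hFb : ∀ x, F (b * x) = b' * F x := fun x => by simp [hF, hv, mul_assoc]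
  have hF1 : F 1 = 1 := by simp [hF]
  have ha : F a = a' := by simpa [hF1] using hFa 1
  have hb : F b = b' := by simpa [hF1] using hFb 1
  have hmul : ∀ g x, F (g * x) = F g * F x := by
    intro g
    have hg : g ∈ Subgroup.closure {a, b} := hgen ▸ Subgroup.mem_top g
    induction hg using Subgroup.closure_induction with
    | mem y hy =>
      rcases hy with rfl | rfl
      · intro x; rw [hFa, ha]
      · intro x; rw [hFb, hb]
    | one => intro x; rw [one_mul, hF1, one_mul]
    | mul y z _ _ hy hz => intro x; rw [mul_assoc, hy, hz, hy, mul_assoc]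
    | inv y _ hy =>
      intro x
      have h1 := hy (y⁻¹ * x)
      have h2 := hy y⁻¹
      rw [mul_inv_cancel_left] at h1
      rw [mul_inv_cancel, hF1] at h2
      rw [h1, eq_inv_of_mul_eq_one_right h2.symm, inv_mul_cancel_left]
  exact ⟨MonoidHom.mk' F hmul, ha, hb⟩

theorem sameCycle_mulLeft_iff (a d d' : G) :
    (Equiv.mulLeft a).SameCycle d d' ↔ d' * d⁻¹ ∈ Subgroup.zpowers a := by
  have h : ∀ n : ℤ, (Equiv.mulLeft a ^ n) d = a ^ n * d := fun n =>
    congrArg (fun s : Equiv.Perm G => s d) (map_zpow (MulAction.toPermHom G G) a n).symm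
  simp only [Equiv.Perm.SameCycle, h, Subgroup.mem_zpowers_iff, eq_mul_inv_iff_mul_eq]

theorem card_sameCycle_mulLeft (a d : G) :
    Nat.card {d' : G // (Equiv.mulLeft a).SameCycle d d'} = orderOf a := by
  rw [← Nat.card_zpowers]
  exact Nat.card_congr ((Equiv.mulRight d⁻¹).subtypeEquiv fun d' => sameCycle_mulLeft_iff a d d')

theorem algebraicMap_hasType (a b : G) :
    (algebraicMap a b).HasType (orderOf (a * b)) (orderOf a) := by
  refine ⟨fun d => ?_, fun d => card_sameCycle_mulLeft a d⟩
  have h : (algebraicMap a b).facePerm = Equiv.mulLeft (a * b) :=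
    (map_mul (MulAction.toPermHom G G) a b).symm
  rw [h, card_sameCycle_mulLeft]

end AlgebraicMap

/-! ### The matrix model of the group. -/

/-- The group of the matrices `!![1, x, z; 0, 1, y; 0, 0, u]` over `ZMod p` with `u` a unit. -/
@[ext] structure MatTwo (p : ℕ) where
  x : ZMod p
  z : ZMod p
  y : ZMod p
  u : (ZMod p)ˣ

namespace MatTwo

variable {p : ℕ}

instance : Mul (MatTwo p) :=
  ⟨fun m n => ⟨m.x + n.x, n.z + m.x * n.y + m.z * n.u, n.y + m.y * n.u, m.u * n.u⟩⟩

instance : One (MatTwo p) := ⟨⟨0, 0, 0, 1⟩⟩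

instance : Inv (MatTwo p) :=
  ⟨fun m => ⟨-m.x, (m.x * m.y - m.z) * (m.u⁻¹ : (ZMod p)ˣ), -m.y * (m.u⁻¹ : (ZMod p)ˣ), m.u⁻¹⟩⟩

@[simp] theorem mul_x (m n : MatTwo p) : (m * n).x = m.x + n.x := rfl
@[simp] theorem mul_z (m n : MatTwo p) : (m * n).z = n.z + m.x * n.y + m.z * n.u := rfl
@[simp] theorem mul_y (m n : MatTwo p) : (m * n).y = n.y + m.y * n.u := rfl
@[simp] theorem mul_u (m n : MatTwo p) : (m * n).u = m.u * n.u := rfl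
@[simp] theorem one_x : (1 : MatTwo p).x = 0 := rfl
@[simp] theorem one_z : (1 : MatTwo p).z = 0 := rfl
@[simp] theorem one_y : (1 : MatTwo p).y = 0 := rfl
@[simp] theorem one_u : (1 : MatTwo p).u = 1 := rfl
theorem inv_x (m : MatTwo p) : (m⁻¹).x = -m.x := rfl
theorem inv_z (m : MatTwo p) :
    (m⁻¹).z = (m.x * m.y - m.z) * (m.u⁻¹ : (ZMod p)ˣ) := rfl
theorem inv_y (m : MatTwo p) : (m⁻¹).y = -m.y * (m.u⁻¹ : (ZMod p)ˣ) := rfl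
theorem inv_u (m : MatTwo p) : (m⁻¹).u = m.u⁻¹ := rfl

instance : Group (MatTwo p) :=
  Group.ofLeftAxioms
    (fun a b c => by
      ext <;> simp only [mul_x, mul_z, mul_y, mul_u, Units.val_mul] <;> ring)
    (fun a => by ext <;> simp)
    (fun a => by
      have h : ((a.u⁻¹ : (ZMod p)ˣ) : ZMod p) * a.u = 1 := by simp
      ext
      · simp [inv_x]
      · simp only [mul_z, inv_z, inv_x, one_z]
        linear_combination (a.x * a.y - a.z) * h
      · simp only [mul_y, inv_y, one_y]
        linear_combination -a.y * h
      · simp [inv_u])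

def equivProd (p : ℕ) : MatTwo p ≃ (ZMod p × ZMod p) × (ZMod p × (ZMod p)ˣ) where
  toFun m := ((m.x, m.z), (m.y, m.u))
  invFun q := ⟨q.1.1, q.1.2, q.2.1, q.2.2⟩
  left_inv _ := rfl
  right_inv _ := rfl

theorem card (hp : p.Prime) : Nat.card (MatTwo p) = p * p * (p * (p - 1)) := by
  have := Fact.mk hp
  rw [Nat.card_congr (equivProd p)]
  simp [ZMod.card_units_eq_totient, Nat.totient_prime hp]

theorem pow_of_x (a : ZMod p) (n : ℕ) : (⟨a, 0, 0, 1⟩ : MatTwo p) ^ n = ⟨n * a, 0, 0, 1⟩ := by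
  induction n with
  | zero => ext <;> simp
  | succ n ih => rw [pow_succ, ih]; ext <;> simp; ring

theorem pow_of_z (a : ZMod p) (n : ℕ) : (⟨0, a, 0, 1⟩ : MatTwo p) ^ n = ⟨0, n * a, 0, 1⟩ := by
  induction n with
  | zero => ext <;> simp
  | succ n ih => rw [pow_succ, ih]; ext <;> simp; ring

theorem pow_of_y (a : ZMod p) (n : ℕ) : (⟨0, 0, a, 1⟩ : MatTwo p) ^ n = ⟨0, 0, n * a, 1⟩ := by
  induction n with
  | zero => ext <;> simp
  | succ n ih => rw [pow_succ, ih]; ext <;> simp; ring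

theorem pow_of_u (v : (ZMod p)ˣ) (n : ℕ) : (⟨0, 0, 0, v⟩ : MatTwo p) ^ n = ⟨0, 0, 0, v ^ n⟩ := by
  induction n with
  | zero => ext <;> simp
  | succ n ih => rw [pow_succ, ih]; ext <;> simp [pow_succ]

theorem pow_of_xu (v : (ZMod p)ˣ) (a : ZMod p) (n : ℕ) :
    (⟨a, 0, 0, v⟩ : MatTwo p) ^ n = ⟨n * a, 0, 0, v ^ n⟩ := by
  induction n with
  | zero => ext <;> simp
  | succ n ih => rw [pow_succ, ih]; ext <;> simp [pow_succ]; ring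

theorem pow_x (m : MatTwo p) (n : ℕ) : (m ^ n).x = n * m.x := by
  induction n with
  | zero => simp
  | succ n ih => rw [pow_succ, mul_x, ih]; push_cast; ring

theorem pow_u (m : MatTwo p) (n : ℕ) : (m ^ n).u = m.u ^ n := by
  induction n with
  | zero => simp
  | succ n ih => rw [pow_succ, mul_u, ih, pow_succ]

theorem pow_unipotent (a b c : ZMod p) (n : ℕ) :
    (⟨a, b, c, 1⟩ : MatTwo p) ^ n = ⟨n * a, n * b + n.choose 2 * (a * c), n * c, 1⟩ := by
  induction n with
  | zero => ext <;> simp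
  | succ n ih =>
    rw [pow_succ, ih]
    ext
    · simp; ring
    · simp [Nat.choose_succ_succ' n 1]; ring
    · simp; ring
    · simp

end MatTwo

/-! ### The presented group is the matrix group. -/

/-- The matrices that the generators of `GroupTwo p t` are mapped to. -/
def GenTwo.toMat (p : ℕ) (t : (ZMod p)ˣ) : GenTwo → MatTwo p
  | .w => ⟨1, 0, 0, 1⟩
  | .z => ⟨0, 1, 0, 1⟩
  | .c => ⟨0, 0, 1, 1⟩
  | .g => ⟨0, 0, 0, t⟩

/-- The relators with the inverses cleared. This form serves both for the matrices and for
automorphism groups of embeddings. -/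
theorem lift_eq_one_of_relTwo {G : Type*} [Group G] {p : ℕ} {t : (ZMod p)ˣ} {f : GenTwo → G}
    (hw : f .w ^ p = 1) (hz : f .z ^ p = 1) (hc : f .c ^ p = 1) (hg : f .g ^ (p - 1) = 1)
    (hwz : f .w * f .z = f .z * f .w) (hcg : f .c * f .g = f .g * f .c ^ (t : ZMod p).val)
    (hwc : f .w * f .c = f .c * (f .w * f .z)) (hzc : f .z * f .c = f .c * f .z)
    (hwg : f .w * f .g = f .g * f .w) (hzg : f .z * f .g = f .g * f .z ^ (t : ZMod p).val) :
    ∀ r ∈ {r | RelTwo p t r}, FreeGroup.lift f r = 1 := by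
  intro r hr
  cases hr with
  | w_pow => simpa using hw
  | z_pow => simpa using hz
  | c_pow => simpa using hc
  | g_pow => simpa using hg
  | w_z =>
    simp only [map_mul, map_inv, FreeGroup.lift_apply_of]
    rw [← mul_inv_rev, mul_assoc, hwz, inv_mul_cancel]
  | c_g =>
    simp only [map_mul, map_inv, map_pow, FreeGroup.lift_apply_of]
    rw [mul_inv_eq_one, mul_assoc, hcg, inv_mul_cancel_left]
  | w_c =>
    simp only [map_mul, map_inv, FreeGroup.lift_apply_of]
    rw [mul_inv_eq_one, mul_assoc, hwc, inv_mul_cancel_left]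
  | z_c =>
    simp only [map_mul, map_inv, FreeGroup.lift_apply_of]
    rw [mul_inv_eq_one, mul_assoc, hzc, inv_mul_cancel_left]
  | w_g =>
    simp only [map_mul, map_inv, FreeGroup.lift_apply_of]
    rw [mul_inv_eq_one, mul_assoc, hwg, inv_mul_cancel_left]
  | z_g =>
    simp only [map_mul, map_inv, map_pow, FreeGroup.lift_apply_of]
    rw [mul_inv_eq_one, mul_assoc, hzg, inv_mul_cancel_left]

namespace GroupTwo

variable {p : ℕ} {t : (ZMod p)ˣ}

local notation "𝐰" => gen p t GenTwo.w
local notation "𝐳" => gen p t GenTwo.z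
local notation "𝐜" => gen p t GenTwo.c
local notation "𝐠" => gen p t GenTwo.g

theorem rel_eq_one {r : FreeGroup GenTwo} (h : RelTwo p t r) :
    (PresentedGroup.mk {r | RelTwo p t r}) r = 1 :=
  (PresentedGroup.one_of_mem (rels := {r | RelTwo p t r}) h)

theorem w_pow : 𝐰 ^ p = 1 := rel_eq_one RelTwo.w_pow
theorem z_pow : 𝐳 ^ p = 1 := rel_eq_one RelTwo.z_pow
theorem c_pow : 𝐜 ^ p = 1 := rel_eq_one RelTwo.c_pow
theorem g_pow : 𝐠 ^ (p - 1) = 1 := rel_eq_one RelTwo.g_pow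

theorem w_mul_z : 𝐰 * 𝐳 = 𝐳 * 𝐰 := by
  have h : 𝐰⁻¹ * 𝐳⁻¹ * 𝐰 * 𝐳 = 1 := rel_eq_one RelTwo.w_z
  rwa [← mul_inv_rev, mul_assoc, inv_mul_eq_one, eq_comm] at h

theorem c_mul_g : 𝐜 * 𝐠 = 𝐠 * 𝐜 ^ (t : ZMod p).val := by
  have h : 𝐠⁻¹ * 𝐜 * 𝐠 * (𝐜 ^ (t : ZMod p).val)⁻¹ = 1 := rel_eq_one RelTwo.c_g
  rwa [mul_inv_eq_one, mul_assoc, inv_mul_eq_iff_eq_mul] at h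

theorem w_mul_c : 𝐰 * 𝐜 = 𝐜 * (𝐰 * 𝐳) := by
  have h : 𝐜⁻¹ * 𝐰 * 𝐜 * (𝐰 * 𝐳)⁻¹ = 1 := rel_eq_one RelTwo.w_c
  rwa [mul_inv_eq_one, mul_assoc, inv_mul_eq_iff_eq_mul] at h

theorem z_mul_c : 𝐳 * 𝐜 = 𝐜 * 𝐳 := by
  have h : 𝐜⁻¹ * 𝐳 * 𝐜 * 𝐳⁻¹ = 1 := rel_eq_one RelTwo.z_c
  rwa [mul_inv_eq_one, mul_assoc, inv_mul_eq_iff_eq_mul] at h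

theorem w_mul_g : 𝐰 * 𝐠 = 𝐠 * 𝐰 := by
  have h : 𝐠⁻¹ * 𝐰 * 𝐠 * 𝐰⁻¹ = 1 := rel_eq_one RelTwo.w_g
  rwa [mul_inv_eq_one, mul_assoc, inv_mul_eq_iff_eq_mul] at h

theorem z_mul_g : 𝐳 * 𝐠 = 𝐠 * 𝐳 ^ (t : ZMod p).val := by
  have h : 𝐠⁻¹ * 𝐳 * 𝐠 * (𝐳 ^ (t : ZMod p).val)⁻¹ = 1 := rel_eq_one RelTwo.z_g
  rwa [mul_inv_eq_one, mul_assoc, inv_mul_eq_iff_eq_mul] at h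

theorem z_pow_mul_g (k : ℕ) : 𝐳 ^ k * 𝐠 = 𝐠 * 𝐳 ^ ((t : ZMod p).val * k) := by
  rw [pow_mul]
  exact (SemiconjBy.pow_right (show SemiconjBy 𝐠 (𝐳 ^ (t : ZMod p).val) 𝐳 from z_mul_g.symm) k).symm

theorem c_pow_mul_g (k : ℕ) : 𝐜 ^ k * 𝐠 = 𝐠 * 𝐜 ^ ((t : ZMod p).val * k) := by
  rw [pow_mul]
  exact (SemiconjBy.pow_right (show SemiconjBy 𝐠 (𝐜 ^ (t : ZMod p).val) 𝐜 from c_mul_g.symm) k).symm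

theorem w_pow_mul_c (k : ℕ) : 𝐰 ^ k * 𝐜 = 𝐜 * (𝐰 ^ k * 𝐳 ^ k) := by
  rw [← (show Commute 𝐰 𝐳 from w_mul_z).mul_pow]
  exact (SemiconjBy.pow_right (show SemiconjBy 𝐜 (𝐰 * 𝐳) 𝐰 from w_mul_c.symm) k).symm

/-- The relations move each generator, multiplied on the right, to its place in the product.
Inverses need no separate treatment, because each generator has finite order. -/
theorem exists_normal_form (hp : 2 ≤ p) (e : GroupTwo p t) :
    ∃ m l i k : ℕ, e = 𝐠 ^ m * (𝐜 ^ l * (𝐰 ^ i * 𝐳 ^ k)) := by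
  have hg : ∀ e : GroupTwo p t, (∃ m l i k : ℕ, e = 𝐠 ^ m * (𝐜 ^ l * (𝐰 ^ i * 𝐳 ^ k))) →
      ∀ s, ∃ m l i k : ℕ, e * gen p t s = 𝐠 ^ m * (𝐜 ^ l * (𝐰 ^ i * 𝐳 ^ k)) := by
    rintro _ ⟨m, l, i, k, rfl⟩ s
    have hwg : Commute (𝐰 ^ i) 𝐠 := (show Commute 𝐰 𝐠 from w_mul_g).pow_left i
    have hzc : Commute (𝐳 ^ k) 𝐜 := (show Commute 𝐳 𝐜 from z_mul_c).pow_left k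
    have hzw : Commute (𝐳 ^ k) 𝐰 := (show Commute 𝐰 𝐳 from w_mul_z).symm.pow_left k
    cases s with
    | w =>
      refine ⟨m, l, i + 1, k, ?_⟩
      rw [pow_succ 𝐰]; simp only [mul_assoc]; rw [hzw.eq]
    | z => exact ⟨m, l, i, k + 1, by rw [pow_succ 𝐳]; simp only [mul_assoc]⟩
    | c =>
      refine ⟨m, l + 1, i, i + k, ?_⟩
      rw [pow_succ 𝐜, pow_add 𝐳]; simp only [mul_assoc]
      rw [hzc.eq, ← mul_assoc (𝐰 ^ i) 𝐜, w_pow_mul_c]; simp only [mul_assoc]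
    | g =>
      refine ⟨m + 1, (t : ZMod p).val * l, i, (t : ZMod p).val * k, ?_⟩
      rw [pow_succ 𝐠]; simp only [mul_assoc]
      rw [z_pow_mul_g, ← mul_assoc (𝐰 ^ i) 𝐠, hwg.eq, mul_assoc 𝐠, ← mul_assoc (𝐜 ^ l) 𝐠,
        c_pow_mul_g, mul_assoc 𝐠]
  have hpow : ∀ s (n : ℕ), ∀ e : GroupTwo p t,
      (∃ m l i k : ℕ, e = 𝐠 ^ m * (𝐜 ^ l * (𝐰 ^ i * 𝐳 ^ k))) →
      ∃ m l i k : ℕ, e * gen p t s ^ n = 𝐠 ^ m * (𝐜 ^ l * (𝐰 ^ i * 𝐳 ^ k)) := by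
    intro s n
    induction n with
    | zero => intro e he; simpa using he
    | succ n ih => intro e he; rw [pow_succ', ← mul_assoc]; exact ih _ (hg e he s)
  have hinv : ∀ s, ∃ n : ℕ, (gen p t s)⁻¹ = gen p t s ^ n := by
    have key : ∀ (x : GroupTwo p t) (n : ℕ), 1 ≤ n → x ^ n = 1 → ∃ n : ℕ, x⁻¹ = x ^ n := by
      intro x n hn hx
      refine ⟨n - 1, inv_eq_of_mul_eq_one_right ?_⟩
      rw [← pow_succ', Nat.sub_add_cancel hn, hx]
    intro s
    cases s with
    | w => exact key _ p (by omega) w_pow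
    | z => exact key _ p (by omega) z_pow
    | c => exact key _ p (by omega) c_pow
    | g => exact key _ (p - 1) (by omega) g_pow
  have he : e ∈ Subgroup.closure (Set.range (PresentedGroup.of : GenTwo → GroupTwo p t)) := by
    rw [PresentedGroup.closure_range_of]; trivial
  induction he using Subgroup.closure_induction_right with
  | one => exact ⟨0, 0, 0, 0, by simp⟩
  | mul_right x _ y hy ih => obtain ⟨s, rfl⟩ := hy; exact hg x ih s
  | mul_inv_cancel x _ y hy ih =>
    obtain ⟨s, rfl⟩ := hy
    obtain ⟨n, hn⟩ := hinv s
    change ∃ m l i k : ℕ, x * (gen p t s)⁻¹ = _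
    rw [hn]
    exact hpow s n x ih

theorem toMat_relations [Fact p.Prime] :
    ∀ r ∈ {r | RelTwo p t r}, FreeGroup.lift (GenTwo.toMat p t) r = 1 := by
  have hv : (((t : ZMod p).val : ℕ) : ZMod p) = t := by simp
  apply lift_eq_one_of_relTwo <;> simp only [GenTwo.toMat]
  · rw [MatTwo.pow_of_x]; ext <;> simp
  · rw [MatTwo.pow_of_z]; ext <;> simp
  · rw [MatTwo.pow_of_y]; ext <;> simp
  · rw [MatTwo.pow_of_u, ZMod.units_pow_card_sub_one_eq_one]; rfl
  · ext <;> simp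
  · rw [MatTwo.pow_of_y, hv]; ext <;> simp
  · ext <;> simp
  · ext <;> simp
  · ext <;> simp
  · rw [MatTwo.pow_of_z, hv]; ext <;> simp

theorem exists_normal_form_lt [Fact p.Prime] (e : GroupTwo p t) :
    ∃ q : (Fin p × Fin p) × (Fin p × Fin (p - 1)),
      𝐠 ^ (q.2.2 : ℕ) * (𝐜 ^ (q.2.1 : ℕ) * (𝐰 ^ (q.1.1 : ℕ) * 𝐳 ^ (q.1.2 : ℕ))) = e := by
  have hp := (Fact.out : p.Prime).two_le
  obtain ⟨m, l, i, k, rfl⟩ := exists_normal_form hp e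
  refine ⟨((⟨i % p, Nat.mod_lt _ (by omega)⟩, ⟨k % p, Nat.mod_lt _ (by omega)⟩),
    (⟨l % p, Nat.mod_lt _ (by omega)⟩, ⟨m % (p - 1), Nat.mod_lt _ (by omega)⟩)), ?_⟩
  simp only
  rw [← pow_eq_pow_mod i w_pow, ← pow_eq_pow_mod k z_pow, ← pow_eq_pow_mod l c_pow,
    ← pow_eq_pow_mod m g_pow]

instance [Fact p.Prime] : Finite (GroupTwo p t) :=
  Finite.of_surjective _ exists_normal_form_lt

theorem card_le [Fact p.Prime] : Nat.card (GroupTwo p t) ≤ p * p * (p * (p - 1)) := by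
  have h := Nat.card_le_card_of_surjective _ (exists_normal_form_lt (p := p) (t := t))
  simpa using h

/-- `GroupTwo p t` is the matrix group. -/
theorem exists_mulEquiv [Fact p.Prime] (ht : ∀ u : (ZMod p)ˣ, u ∈ Subgroup.zpowers t) :
    ∃ E : GroupTwo p t ≃* MatTwo p, ∀ s, E (gen p t s) = GenTwo.toMat p t s := by
  have hp : p.Prime := Fact.out
  set E : GroupTwo p t →* MatTwo p := PresentedGroup.toGroup toMat_relations with hE
  have hs : ∀ s, E (gen p t s) = GenTwo.toMat p t s := fun s => PresentedGroup.toGroup.of _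
  have hsurj : Function.Surjective E := by
    rintro ⟨x, z, y, u⟩
    obtain ⟨m, rfl⟩ : ∃ n : ℕ, t ^ n = u := mem_powers_iff_mem_zpowers.mpr (ht u)
    refine ⟨𝐠 ^ m * (𝐜 ^ (y.val) * (𝐰 ^ x.val * 𝐳 ^ z.val)), ?_⟩
    simp only [map_mul, map_pow, hs, GenTwo.toMat, MatTwo.pow_of_x, MatTwo.pow_of_y,
      MatTwo.pow_of_z, MatTwo.pow_of_u]
    ext <;> simp
  -- Normal forms bound the order of the source by the order of the target, so surjectivity
  -- suffices.
  have hb : Function.Bijective E := by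
    refine (Nat.bijective_iff_surjective_and_card E).mpr ⟨hsurj, le_antisymm ?_ ?_⟩
    · rw [MatTwo.card hp]; exact card_le
    · exact Nat.card_le_card_of_surjective _ hsurj
  exact ⟨MulEquiv.ofBijective E hb, hs⟩

theorem card_eq [Fact p.Prime] (ht : ∀ u : (ZMod p)ˣ, u ∈ Subgroup.zpowers t) :
    Nat.card (GroupTwo p t) = p * p * (p * (p - 1)) := by
  obtain ⟨E, -⟩ := exists_mulEquiv ht
  rw [Nat.card_congr E.toEquiv, MatTwo.card Fact.out]

end GroupTwo

/-! ### Generators of the unit group modulo `p`. -/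

theorem orderOf_unit_generator {p : ℕ} [Fact p.Prime] {s : (ZMod p)ˣ}
    (hs : ∀ u : (ZMod p)ˣ, u ∈ Subgroup.zpowers s) : orderOf s = p - 1 := by
  rw [orderOf_eq_card_of_forall_mem_zpowers hs, Nat.card_eq_fintype_card,
    ZMod.card_units_eq_totient, Nat.totient_prime Fact.out]

theorem unit_generator_pow_half {p : ℕ} [Fact p.Prime] (hp : 5 ≤ p) {s : (ZMod p)ˣ}
    (hs : ∀ u : (ZMod p)ˣ, u ∈ Subgroup.zpowers s) : s ^ ((p - 1) / 2) = -1 := by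
  have ho := orderOf_unit_generator hs
  have hodd : p % 2 = 1 := (Nat.Prime.eq_two_or_odd Fact.out).resolve_left (by omega)
  have h2 : (s ^ ((p - 1) / 2)) ^ 2 = 1 := by
    rw [← pow_mul, Nat.div_mul_cancel (by omega), ← ho, pow_orderOf_eq_one]
  have h1 : s ^ ((p - 1) / 2) ≠ 1 := by
    rw [Ne, ← orderOf_dvd_iff_pow_eq_one, ho]
    exact fun h => absurd (Nat.le_of_dvd (by omega) h) (by omega)
  have h3 : ((s ^ ((p - 1) / 2) : (ZMod p)ˣ) : ZMod p) ^ 2 = 1 := by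
    rw [← Units.val_pow_eq_pow_val, h2, Units.val_one]
  rcases mul_self_eq_one_iff.mp ((sq _).symm.trans h3) with h | h
  · exact absurd (Units.ext h) h1
  · exact Units.ext h

theorem unit_generator_pow {p : ℕ} [Fact p.Prime] {t : (ZMod p)ˣ}
    (ht : ∀ u : (ZMod p)ˣ, u ∈ Subgroup.zpowers t) (j : (ZMod (p - 1))ˣ) :
    ∀ u : (ZMod p)ˣ, u ∈ Subgroup.zpowers (t ^ (j : ZMod (p - 1)).val) := by
  have hp : p.Prime := Fact.out
  have : NeZero (p - 1) := ⟨by have := hp.two_le; omega⟩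
  have hc : (orderOf t).Coprime (j : ZMod (p - 1)).val := by
    rw [orderOf_unit_generator ht]; exact (ZMod.val_coe_unit_coprime j).symm
  obtain ⟨m, hm⟩ := exists_pow_eq_self_of_coprime hc.symm
  intro u
  have ht' : t ∈ Subgroup.zpowers (t ^ (j : ZMod (p - 1)).val) :=
    Subgroup.mem_zpowers_iff.mpr ⟨m, by rw [zpow_natCast, hm]⟩
  exact (Subgroup.zpowers_le.mpr ht') (ht u)

/-! ### Generation, rigidity and element orders in the matrix group. -/

namespace MatTwo

variable {p : ℕ}

/-- The involution `c * g ^ ((p - 1) / 2)`. -/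
def flip (p : ℕ) : MatTwo p := ⟨0, 0, -1, -1⟩

theorem flip_mul_flip : flip p * flip p = 1 := by ext <;> simp [flip]

variable [Fact p.Prime]

/-- The `p`-th power kills the shear and, by Fermat, keeps the unit; it thus extracts the diagonal
factor of `a`. -/
theorem pow_prime (s : (ZMod p)ˣ) (x : ZMod p) :
    (⟨x, 0, 0, s⟩ : MatTwo p) ^ p = ⟨0, 0, 0, s⟩ := by
  rw [pow_of_xu]
  have h : s ^ p = s := Units.ext (by rw [Units.val_pow_eq_pow_val, ZMod.pow_card])
  rw [h]; simp

theorem diag_and_shear_mem {s : (ZMod p)ˣ} (hs : ∀ u : (ZMod p)ˣ, u ∈ Subgroup.zpowers s)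
    {S : Subgroup (MatTwo p)} (ha : (⟨1, 0, 0, s⟩ : MatTwo p) ∈ S) :
    (∀ u : (ZMod p)ˣ, (⟨0, 0, 0, u⟩ : MatTwo p) ∈ S) ∧ (⟨1, 0, 0, 1⟩ : MatTwo p) ∈ S := by
  have hu : ∀ u : (ZMod p)ˣ, (⟨0, 0, 0, u⟩ : MatTwo p) ∈ S := by
    intro u
    obtain ⟨n, rfl⟩ : ∃ n : ℕ, s ^ n = u := mem_powers_iff_mem_zpowers.mpr (hs u)
    rw [← pow_of_u, ← pow_prime s 1]
    exact S.pow_mem (S.pow_mem ha _) _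
  refine ⟨hu, ?_⟩
  have h := S.mul_mem ha (hu s⁻¹)
  convert h using 1
  ext <;> simp only [mul_x, mul_z, mul_y, mul_u, mul_inv_cancel] <;> ring

theorem closure_eq_top {s : (ZMod p)ˣ} (hs : ∀ u : (ZMod p)ˣ, u ∈ Subgroup.zpowers s) :
    Subgroup.closure {(⟨1, 0, 0, s⟩ : MatTwo p), flip p} = ⊤ := by
  set S := Subgroup.closure {(⟨1, 0, 0, s⟩ : MatTwo p), flip p} with hS
  have ha : (⟨1, 0, 0, s⟩ : MatTwo p) ∈ S := Subgroup.subset_closure (by simp)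
  have hb : flip p ∈ S := Subgroup.subset_closure (by simp)
  obtain ⟨hu, hw⟩ := diag_and_shear_mem hs ha
  have hc : (⟨0, 0, 1, 1⟩ : MatTwo p) ∈ S := by
    have h := S.mul_mem hb (hu (-1))
    convert h using 1
    ext <;> simp [flip]
  -- The central matrix is the commutator `(c w)⁻¹ (w c)`.
  have hz : (⟨0, 1, 0, 1⟩ : MatTwo p) ∈ S := by
    have h := S.mul_mem (S.inv_mem (S.mul_mem hc hw)) (S.mul_mem hw hc)
    convert h using 1
    rw [eq_inv_mul_iff_mul_eq]
    ext <;> simp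
  rw [eq_top_iff]
  rintro ⟨x, z, y, u⟩ -
  have h := S.mul_mem (hu u) (S.mul_mem (S.pow_mem hc y.val)
    (S.mul_mem (S.pow_mem hw x.val) (S.pow_mem hz z.val)))
  convert h using 1
  simp only [pow_of_x, pow_of_y, pow_of_z]
  ext <;> simp

/-- A homomorphism between two groups of this kind determines the multiplier. -/
theorem unit_eq_of_monoidHom (hp : 5 ≤ p) {s s' : (ZMod p)ˣ} {x' : ZMod p}
    (hs : ∀ u : (ZMod p)ˣ, u ∈ Subgroup.zpowers s)
    (hs' : ∀ u : (ZMod p)ˣ, u ∈ Subgroup.zpowers s') (σ : MatTwo p →* MatTwo p)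
    (ha : σ ⟨1, 0, 0, s⟩ = ⟨x', 0, 0, s'⟩) (hb : σ (flip p) = flip p) : s = s' := by
  -- Taking `p`-th powers shows where the diagonal part goes. Its power `-1` is then fixed, so `c`,
  -- which is `flip p` times that power, is fixed too. Finally `c^g = c^s` reads off the multiplier.
  have h1 : σ ⟨0, 0, 0, s⟩ = ⟨0, 0, 0, s'⟩ := by
    rw [← pow_prime s 1, map_pow, ha, pow_prime]
  have h2 : σ ⟨0, 0, 0, -1⟩ = ⟨0, 0, 0, -1⟩ := by
    have := congrArg (· ^ ((p - 1) / 2)) h1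
    simp only [← map_pow, pow_of_u] at this
    rwa [unit_generator_pow_half hp hs, unit_generator_pow_half hp hs'] at this
  have h3 : σ ⟨0, 0, 1, 1⟩ = ⟨0, 0, 1, 1⟩ := by
    have h : (⟨0, 0, 1, 1⟩ : MatTwo p) = flip p * ⟨0, 0, 0, -1⟩ := by ext <;> simp [flip]
    rw [h, map_mul, hb, h2]
  have h4 : (⟨0, 0, 1, 1⟩ : MatTwo p) * ⟨0, 0, 0, s⟩ =
      ⟨0, 0, 0, s⟩ * ⟨0, 0, 1, 1⟩ ^ (s : ZMod p).val := by
    rw [pow_of_y]; ext <;> simp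
  have h5 := congrArg σ h4
  rw [map_mul, map_mul, map_pow, h1, h3, pow_of_y] at h5
  have h6 := congrArg MatTwo.y h5
  simp at h6
  exact (Units.ext h6).symm

theorem orderOf_xu (s : (ZMod p)ˣ) (hs : orderOf s = p - 1) :
    orderOf (⟨1, 0, 0, s⟩ : MatTwo p) = p * (p - 1) := by
  have hp : p.Prime := Fact.out
  have hcop : p.Coprime (p - 1) := (Nat.coprime_self_sub_right hp.one_le).mpr (by simp)
  have key : ∀ k : ℕ, (⟨1, 0, 0, s⟩ : MatTwo p) ^ k = 1 ↔ p * (p - 1) ∣ k := by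
    intro k
    have h : p * (p - 1) ∣ k ↔ p ∣ k ∧ p - 1 ∣ k :=
      ⟨fun h => ⟨(dvd_mul_right _ _).trans h, (dvd_mul_left _ _).trans h⟩,
        fun h => hcop.mul_dvd_of_dvd_of_dvd h.1 h.2⟩
    rw [pow_of_xu, h, ← hs, orderOf_dvd_iff_pow_eq_one, ← ZMod.natCast_eq_zero_iff, MatTwo.ext_iff]
    simp
  exact Nat.dvd_antisymm (orderOf_dvd_of_pow_eq_one ((key _).mpr dvd_rfl))
    ((key _).mp (pow_orderOf_eq_one _))

/-- The order of `m.u` divides `p - 1`, so it is prime to `p`. The corresponding power of `m` is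
unipotent and is killed by `p`, because the odd prime `p` divides `p.choose 2`; the entry `x = 1`
shows that `p` divides the order of `m`. -/
theorem orderOf_face (hp : 5 ≤ p) (m : MatTwo p) (hm : m.x = 1) :
    orderOf m = p * orderOf m.u := by
  have hpp : p.Prime := Fact.out
  have hcop : p.Coprime (orderOf m.u) := by
    rw [hpp.coprime_iff_not_dvd]
    intro h
    have h1 : orderOf m.u ∣ p - 1 :=
      orderOf_dvd_of_pow_eq_one (ZMod.units_pow_card_sub_one_eq_one _ _)
    exact absurd (Nat.le_of_dvd (by omega) (h.trans h1)) (by omega)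
  apply Nat.dvd_antisymm
  · apply orderOf_dvd_of_pow_eq_one
    have h : m ^ orderOf m.u = ⟨(m ^ orderOf m.u).x, (m ^ orderOf m.u).z,
        (m ^ orderOf m.u).y, 1⟩ := by
      ext <;> simp [pow_u, pow_orderOf_eq_one]
    rw [mul_comm, pow_mul, h, pow_unipotent]
    have h2 : ((p.choose 2 : ℕ) : ZMod p) = 0 := by
      rw [ZMod.natCast_eq_zero_iff]
      exact hpp.dvd_choose_self (by norm_num) (by omega)
    ext <;> simp [h2]
  · refine hcop.mul_dvd_of_dvd_of_dvd ?_ ?_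
    · have h := congrArg MatTwo.x (pow_orderOf_eq_one m)
      rw [pow_x, hm, mul_one, one_x] at h
      exact (ZMod.natCast_eq_zero_iff _ _).mp h
    · have h := congrArg MatTwo.u (pow_orderOf_eq_one m)
      rw [pow_u] at h
      exact orderOf_dvd_of_pow_eq_one h

end MatTwo

theorem mapTwo_isomorphic {p : ℕ} [Fact p.Prime] (hp : 5 ≤ p) {t : (ZMod p)ˣ}
    (ht : ∀ u : (ZMod p)ˣ, u ∈ Subgroup.zpowers t) (j : (ZMod (p - 1))ˣ) :
    ∃ E : GroupTwo p t ≃* MatTwo p,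
      E (GroupTwo.gen p t .w * GroupTwo.gen p t .g ^ (j : ZMod (p - 1)).val) =
        ⟨1, 0, 0, t ^ (j : ZMod (p - 1)).val⟩ ∧
      E (GroupTwo.gen p t .c * GroupTwo.gen p t .g ^ ((p - 1) / 2)) = MatTwo.flip p := by
  obtain ⟨E, hE⟩ := GroupTwo.exists_mulEquiv ht
  refine ⟨E, ?_, ?_⟩
  · rw [map_mul, map_pow, hE, hE]
    simp only [GenTwo.toMat, MatTwo.pow_of_u]
    ext <;> simp
  · rw [map_mul, map_pow, hE, hE]
    simp only [GenTwo.toMat, MatTwo.pow_of_u, unit_generator_pow_half hp ht]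
    ext <;> simp [MatTwo.flip]

/-! ### The embedding of the complete multipartite graph given by the matrices. -/

namespace MatTwo

variable {p : ℕ}

/-- The vertex at which the arc represented by a matrix starts. -/
def vertex (m : MatTwo p) : ZMod p × ZMod p := (m.y, m.z - m.x * m.y)

/-- The action of the matrices on the vertices. -/
def act (m : MatTwo p) (v : ZMod p × ZMod p) : ZMod p × ZMod p :=
  (m.y + v.1 * m.u, m.z + v.2 * m.u - m.x * m.y - m.x * v.1 * m.u)

theorem vertex_mul (m n : MatTwo p) : vertex (m * n) = act n (vertex m) := by
  ext
  · simp [vertex, act]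
  · simp only [vertex, act, mul_x, mul_y, mul_z]; ring

theorem act_mul (m n : MatTwo p) (v : ZMod p × ZMod p) : act (m * n) v = act n (act m v) := by
  ext
  · simp only [act, mul_x, mul_y, mul_z, mul_u, Units.val_mul]; ring
  · simp only [act, mul_x, mul_y, mul_z, mul_u, Units.val_mul]; ring

theorem act_one (v : ZMod p × ZMod p) : act 1 v = v := by
  ext <;> simp [act]

theorem vertex_rot (s : (ZMod p)ˣ) (m : MatTwo p) : vertex (⟨1, 0, 0, s⟩ * m) = vertex m := by
  ext
  · simp [vertex]
  · simp only [vertex, mul_x, mul_y, mul_z]; ring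

theorem vertex_flip_mul (m : MatTwo p) :
    vertex (flip p * m) = (m.y - m.u, m.z - m.x * m.y + m.x * m.u) := by
  ext
  · simp only [vertex, flip, mul_y]; ring
  · simp only [vertex, flip, mul_x, mul_y, mul_z]; ring

variable [Fact p.Prime]

/-- The labelling of the vertices by the elements of `Fin p × Fin p`. -/
def label (p : ℕ) [Fact p.Prime] : ZMod p × ZMod p ≃ Fin p × Fin p :=
  Equiv.prodCongr (ZMod.finEquiv p).symm.toEquiv (ZMod.finEquiv p).symm.toEquiv

theorem label_fst_eq_iff (v v' : ZMod p × ZMod p) :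
    (label p v).1 = (label p v').1 ↔ v.1 = v'.1 :=
  (ZMod.finEquiv p).symm.toEquiv.apply_eq_iff_eq

theorem adj_label (m : MatTwo p) :
    (SimpleGraph.completeEquipartiteGraph p p).Adj (label p (vertex m))
      (label p (vertex (flip p * m))) := by
  rw [SimpleGraph.completeEquipartiteGraph_adj, Ne, label_fst_eq_iff, vertex_flip_mul]
  intro h
  change m.y = m.y - m.u at h
  exact m.u.ne_zero (by linear_combination h)

/-- The arc represented by a matrix. -/
def dart (m : MatTwo p) : (SimpleGraph.completeEquipartiteGraph p p).Dart :=
  ⟨(label p (vertex m), label p (vertex (flip p * m))), adj_label m⟩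

theorem dart_eq_iff (m n : MatTwo p) :
    dart m = dart n ↔ vertex m = vertex n ∧ vertex (flip p * m) = vertex (flip p * n) := by
  rw [SimpleGraph.Dart.ext_iff, Prod.ext_iff]
  simp [dart]

/-- The part is the coordinate `y`, and the arc of a matrix leads from the point `(y, z - x y)` to
the part `y - u`. Thus `u` is the difference of the two parts, and the slope of the line through the
two points determines `x`. -/
theorem dart_bijective : Function.Bijective (dart : MatTwo p → _) := by
  constructor
  · intro m n h
    obtain ⟨h1, h2⟩ := (dart_eq_iff m n).mp h
    rw [vertex_flip_mul, vertex_flip_mul, Prod.ext_iff] at h2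
    rw [vertex, vertex, Prod.ext_iff] at h1
    obtain ⟨h1, h3⟩ := h1
    obtain ⟨h2, h4⟩ := h2
    simp only at h1 h2 h3 h4
    have hu : m.u = n.u := Units.ext (by linear_combination h1 - h2)
    have hx : m.x = n.x := by
      refine m.u.isUnit.mul_right_cancel ?_
      have : (m.u : ZMod p) = n.u := by rw [hu]
      linear_combination h4 - h3 + n.x * (this - this) - n.x * this
    refine MatTwo.ext hx ?_ h1 hu
    rw [hx, h1] at h3
    exact sub_left_injective h3
  · rintro ⟨⟨v, v'⟩, hv⟩
    obtain ⟨⟨y, s⟩, rfl⟩ := (label p).surjective v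
    obtain ⟨⟨y', s'⟩, rfl⟩ := (label p).surjective v'
    have hne : y - y' ≠ 0 := by
      intro h
      exact hv ((label_fst_eq_iff _ _).mpr (sub_eq_zero.mp h))
    set x := (s' - s) / (y - y') with hx
    refine ⟨⟨x, s + x * y, y, Units.mk0 _ hne⟩, ?_⟩
    rw [SimpleGraph.Dart.ext_iff, Prod.ext_iff]
    refine ⟨congrArg (label p) ?_, congrArg (label p) ?_⟩
    · ext <;> simp [vertex]
    · rw [vertex_flip_mul]
      ext
      · simp
      · simp [hx, hne]

/-- The arcs of the graph are in bijection with the matrices. -/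
noncomputable def dartEquiv (p : ℕ) [Fact p.Prime] :
    MatTwo p ≃ (SimpleGraph.completeEquipartiteGraph p p).Dart :=
  Equiv.ofBijective dart dart_bijective

theorem dartEquiv_apply (m : MatTwo p) : dartEquiv p m = dart m := rfl

theorem dart_flip (m : MatTwo p) : dart (flip p * m) = (dart m).symm := by
  rw [SimpleGraph.Dart.ext_iff]
  change (_, label p (vertex (flip p * (flip p * m)))) = _
  rw [← mul_assoc, flip_mul_flip, one_mul]
  rfl

/-- The group `⟨a⟩` contains all diagonal matrices and all shears in `x`, and these are exactly what
`vertex` does not see. -/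
theorem mem_zpowers_of_vertex_eq {s : (ZMod p)ˣ}
    (hs : ∀ u : (ZMod p)ˣ, u ∈ Subgroup.zpowers s) {m n : MatTwo p} (h : vertex m = vertex n) :
    n * m⁻¹ ∈ Subgroup.zpowers (⟨1, 0, 0, s⟩ : MatTwo p) := by
  set S := Subgroup.zpowers (⟨1, 0, 0, s⟩ : MatTwo p) with hS
  have ha : (⟨1, 0, 0, s⟩ : MatTwo p) ∈ S := Subgroup.mem_zpowers _
  obtain ⟨hu, hw⟩ := diag_and_shear_mem hs ha
  have h1 := S.mul_mem (S.pow_mem hw (n.x - m.x).val) (hu (n.u * m.u⁻¹))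
  convert h1 using 1
  rw [mul_inv_eq_iff_eq_mul, pow_of_x]
  rw [vertex, vertex, Prod.ext_iff] at h
  obtain ⟨hy, hz⟩ := h
  simp only at hy hz
  ext
  · simp
  · rw [← hy] at hz
    simp only [mul_x, mul_z, mul_one, ZMod.natCast_val, ZMod.cast_id', id]
    linear_combination -hz
  · simp only [mul_y, hy]; ring
  · simp only [mul_u, inv_mul_cancel_right, one_mul]

theorem connected_completeEquipartiteGraph {m n : ℕ} (hm : 2 ≤ m) (hn : 1 ≤ n) :
    (SimpleGraph.completeEquipartiteGraph m n).Connected := by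
  have : Nonempty (Fin m × Fin n) := ⟨(⟨0, by omega⟩, ⟨0, by omega⟩)⟩
  refine ⟨fun v v' => ?_⟩
  have hadj : ∀ v v' : Fin m × Fin n, v.1 ≠ v'.1 →
      (SimpleGraph.completeEquipartiteGraph m n).Reachable v v' := fun v v' h =>
    SimpleGraph.Adj.reachable h
  by_cases h : v.1 = v'.1
  · have : Nontrivial (Fin m) := Fin.nontrivial_iff_two_le.mpr hm
    obtain ⟨i, hi⟩ := exists_ne v.1
    exact (hadj v (i, v.2) hi.symm).trans (hadj (i, v.2) v' (h ▸ hi))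
  · exact hadj v v' h

/-- The embedding of `K_{p[p]}` defined by the matrix group. -/
noncomputable def embedding {s : (ZMod p)ˣ} (hs : ∀ u : (ZMod p)ˣ, u ∈ Subgroup.zpowers s) :
    OrientedEmbedding (SimpleGraph.completeEquipartiteGraph p p) where
  connected := connected_completeEquipartiteGraph (Nat.Prime.two_le Fact.out)
    (Nat.Prime.one_le Fact.out)
  rotation := (dartEquiv p).permCongr (Equiv.mulLeft ⟨1, 0, 0, s⟩)
  fst_rotation d := by
    obtain ⟨m, rfl⟩ := (dartEquiv p).surjective d
    rw [Equiv.permCongr_apply, Equiv.symm_apply_apply]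
    exact congrArg (label p) (vertex_rot s m)
  sameCycle d d' h := by
    obtain ⟨m, rfl⟩ := (dartEquiv p).surjective d
    obtain ⟨n, rfl⟩ := (dartEquiv p).surjective d'
    obtain ⟨k, hk⟩ := (sameCycle_mulLeft_iff _ m n).mpr
      (mem_zpowers_of_vertex_eq hs ((label p).injective h))
    refine ⟨k, ?_⟩
    have h1 : (dartEquiv p).permCongr (Equiv.mulLeft (⟨1, 0, 0, s⟩ : MatTwo p)) =
      (dartEquiv p).permCongrHom (Equiv.mulLeft ⟨1, 0, 0, s⟩) := rfl
    rw [h1, ← map_zpow]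
    change dartEquiv p ((Equiv.mulLeft (⟨1, 0, 0, s⟩ : MatTwo p) ^ k)
      ((dartEquiv p).symm (dartEquiv p m))) = _
    rw [Equiv.symm_apply_apply, hk]

variable {s : (ZMod p)ˣ} (hs : ∀ u : (ZMod p)ˣ, u ∈ Subgroup.zpowers s)

theorem embedding_rotation (m : MatTwo p) :
    (embedding hs).rotation (dart m) = dart (⟨1, 0, 0, s⟩ * m) := by
  change (dartEquiv p).permCongr (Equiv.mulLeft ⟨1, 0, 0, s⟩) (dartEquiv p m) = _
  rw [Equiv.permCongr_apply, Equiv.symm_apply_apply]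
  rfl

theorem embedding_isomorphic :
    (embedding hs).toArcMap.Isomorphic (algebraicMap ⟨1, 0, 0, s⟩ (flip p)) := by
  apply ArcMap.Isomorphic.symm
  exact ⟨dartEquiv p, fun m => (embedding_rotation hs m).symm, fun m => dart_flip m⟩

/-- The automorphism of the graph given by the action of a matrix. -/
def graphIso (m : MatTwo p) :
    SimpleGraph.completeEquipartiteGraph p p ≃g SimpleGraph.completeEquipartiteGraph p p where
  toFun v := label p (act m ((label p).symm v))
  invFun v := label p (act m⁻¹ ((label p).symm v))
  left_inv v := by simp [← act_mul, act_one]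
  right_inv v := by simp [← act_mul, act_one]
  map_rel_iff' {v v'} := by
    obtain ⟨v, rfl⟩ := (label p).surjective v
    obtain ⟨v', rfl⟩ := (label p).surjective v'
    simp [label_fst_eq_iff, act]

/-- Automorphisms act by right multiplication, which commutes with the left multiplications defining
rotation and reversal. -/
theorem onArcs_graphIso (m n : MatTwo p) :
    OrientedEmbedding.onArcs (graphIso m) (dart n) = dart (n * m) := by
  rw [SimpleGraph.Dart.ext_iff]
  change (label p (act m ((label p).symm (label p (vertex n)))),
    label p (act m ((label p).symm (label p (vertex (flip p * n)))))) = _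
  rw [Equiv.symm_apply_apply, Equiv.symm_apply_apply, ← vertex_mul, ← vertex_mul, mul_assoc]
  rfl

end MatTwo

/-! ### Rigidity of orientation-preserving automorphisms. -/

namespace OrientedEmbedding

variable {V : Type*} {Γ : SimpleGraph V}

theorem onArcs_symm (φ : Γ ≃g Γ) (d : Γ.Dart) : onArcs φ d.symm = (onArcs φ d).symm := rfl

/-- An orientation-preserving automorphism commutes with all powers of the rotation. -/
theorem onArcs_rotation_zpow (M : OrientedEmbedding Γ) (φ : M.autPlus) (n : ℤ) (d : Γ.Dart) :
    onArcs φ.1 ((M.rotation ^ n) d) = (M.rotation ^ n) (onArcs φ.1 d) := by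
  have h1 : ∀ n : ℕ, ∀ d, onArcs φ.1 ((M.rotation ^ n) d) = (M.rotation ^ n) (onArcs φ.1 d) := by
    intro n
    induction n with
    | zero => intro d; rfl
    | succ n ih => intro d; rw [pow_succ, Equiv.Perm.mul_apply, ih, φ.2 d]; rfl
  cases n with
  | ofNat n => exact h1 n d
  | negSucc n =>
    rw [zpow_negSucc, Equiv.Perm.eq_inv_iff_eq, ← h1]
    simp

/-- An orientation-preserving automorphism is determined by its action on one arc. -/
theorem autPlus_ext (M : OrientedEmbedding Γ) {φ : M.autPlus} {d : Γ.Dart}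
    (h : onArcs φ.1 d = d) : φ = 1 := by
  -- Fixing one arc at a vertex fixes all arcs there, since they form one cycle of the rotation.
  -- Reversal carries this to the neighbours, and connectedness to the whole graph.
  have key : ∀ d' d'' : Γ.Dart, d'.fst = d''.fst → onArcs φ.1 d' = d' → onArcs φ.1 d'' = d'' := by
    intro d' d'' hd h
    obtain ⟨n, rfl⟩ := M.sameCycle d' d'' hd
    rw [onArcs_rotation_zpow, h]
  have hall : ∀ v, Γ.Reachable d.fst v → ∀ d' : Γ.Dart, d'.fst = v → onArcs φ.1 d' = d' := by
    rintro v ⟨q⟩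
    generalize hu : d.fst = u at q
    have h0 : ∀ d' : Γ.Dart, d'.fst = u → onArcs φ.1 d' = d' := fun d' hd' =>
      key d d' (hu.trans hd'.symm) h
    clear hu
    induction q with
    | nil => exact h0
    | cons hadj q ih =>
      apply ih
      intro d' hd'
      refine key (SimpleGraph.Dart.mk (_, _) hadj).symm d' hd'.symm ?_
      rw [onArcs_symm, h0 _ rfl]
  apply Subtype.ext
  apply RelIso.ext
  intro v
  by_cases hv : ∃ u, Γ.Adj v u
  · obtain ⟨u, hu⟩ := hv
    have := hall v (M.connected.preconnected _ _) ⟨(v, u), hu⟩ rfl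
    exact congrArg (fun d : Γ.Dart => d.fst) this
  · have hv' : v = d.fst := by
      obtain ⟨q⟩ := M.connected.preconnected v d.fst
      cases q with
      | nil => rfl
      | cons h _ => exact absurd ⟨_, h⟩ hv
    exact absurd ⟨d.snd, hv' ▸ d.adj⟩ hv

theorem autPlus_eq {M : OrientedEmbedding Γ} {φ ψ : M.autPlus} {d : Γ.Dart}
    (h : onArcs φ.1 d = onArcs ψ.1 d) : φ = ψ := by
  refine (eq_of_inv_mul_eq_one (M.autPlus_ext (d := d) ?_)).symm
  change onArcs (ψ.1⁻¹ * φ.1) d = d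
  rw [onArcs_mul, h, onArcs_inv_cancel]

end OrientedEmbedding

namespace MatTwo

variable {p : ℕ} [Fact p.Prime] {s : (ZMod p)ˣ}

theorem embedding_isOrientablyRegular (hs : ∀ u : (ZMod p)ˣ, u ∈ Subgroup.zpowers s) :
    (embedding hs).IsOrientablyRegular := by
  intro d d'
  obtain ⟨m, rfl⟩ := (dartEquiv p).surjective d
  obtain ⟨n, rfl⟩ := (dartEquiv p).surjective d'
  have hmem : graphIso (m⁻¹ * n) ∈ (embedding hs).autPlus := by
    intro d
    obtain ⟨k, rfl⟩ := (dartEquiv p).surjective d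
    rw [dartEquiv_apply, embedding_rotation, onArcs_graphIso, onArcs_graphIso, embedding_rotation,
      mul_assoc]
  have hφ : OrientedEmbedding.onArcs (graphIso (m⁻¹ * n)) (dart m) = dart n := by
    rw [onArcs_graphIso, mul_inv_cancel_left]
  refine ⟨⟨graphIso (m⁻¹ * n), hmem⟩, hφ, fun ψ hψ => ?_⟩
  change OrientedEmbedding.onArcs ψ.1 (dart m) = dart n at hψ
  exact OrientedEmbedding.autPlus_eq (hψ.trans hφ.symm)

end MatTwo

/-! ### Uniqueness of `j`, chirality, type and realization of the maps. -/

section MapTwo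

variable {p : ℕ} [Fact p.Prime] {t : (ZMod p)ˣ}

theorem mapTwo_multiplier_eq (hp : 5 ≤ p) (ht : ∀ u : (ZMod p)ˣ, u ∈ Subgroup.zpowers t)
    {j₁ j₂ : (ZMod (p - 1))ˣ} (h : (mapTwo p t j₁).Isomorphic (mapTwo p t j₂)) : j₁ = j₂ := by
  obtain ⟨E₁, ha₁, hb₁⟩ := mapTwo_isomorphic hp ht j₁
  obtain ⟨E₂, ha₂, hb₂⟩ := mapTwo_isomorphic hp ht j₂
  have h1 := (algebraicMap_isomorphic_map E₁ _ _).symm.trans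
    (h.trans (algebraicMap_isomorphic_map E₂ _ _))
  rw [ha₁, hb₁, ha₂, hb₂] at h1
  have hs₁ := unit_generator_pow ht j₁
  have hs₂ := unit_generator_pow ht j₂
  obtain ⟨σ, ha, hb⟩ := exists_monoidHom_of_isomorphic (MatTwo.closure_eq_top hs₁) h1
  have h2 := MatTwo.unit_eq_of_monoidHom hp hs₁ hs₂ σ ha hb
  have : NeZero (p - 1) := ⟨by omega⟩
  apply Units.ext
  apply ZMod.val_injective
  refine pow_injOn_Iio_orderOf ?_ ?_ h2
  all_goals rw [orderOf_unit_generator ht]; exact ZMod.val_lt _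

theorem mapTwo_chiral (hp : 5 ≤ p) (ht : ∀ u : (ZMod p)ˣ, u ∈ Subgroup.zpowers t)
    (j : (ZMod (p - 1))ˣ) : (mapTwo p t j).Chiral := by
  intro h
  obtain ⟨E, ha, hb⟩ := mapTwo_isomorphic hp ht j
  have h0 := algebraicMap_isomorphic_map E (GroupTwo.gen p t .w *
    GroupTwo.gen p t .g ^ (j : ZMod (p - 1)).val) (GroupTwo.gen p t .c *
    GroupTwo.gen p t .g ^ ((p - 1) / 2))
  have h1 := h0.symm.trans (h.trans h0.mirror)
  rw [ha, hb, algebraicMap_mirror] at h1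
  have hs := unit_generator_pow ht j
  set s := t ^ (j : ZMod (p - 1)).val with hs_def
  obtain ⟨σ, ha', hb'⟩ := exists_monoidHom_of_isomorphic (MatTwo.closure_eq_top hs) h1
  have hinv : (⟨1, 0, 0, s⟩ : MatTwo p)⁻¹ = ⟨-1, 0, 0, s⁻¹⟩ := by
    rw [inv_eq_iff_mul_eq_one]
    ext <;> simp only [MatTwo.mul_x, MatTwo.mul_z, MatTwo.mul_y, MatTwo.mul_u, mul_inv_cancel,
      MatTwo.one_x, MatTwo.one_y, MatTwo.one_z, MatTwo.one_u] <;> ring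
  rw [hinv] at ha'
  have h2 := MatTwo.unit_eq_of_monoidHom hp hs
    (fun u => by rw [Subgroup.zpowers_inv]; exact hs u) σ ha' hb'
  -- A reflection would make the multiplier equal to its inverse, but its order is `p - 1 ≥ 4`.
  have h3 : s ^ 2 = 1 := by rw [sq]; nth_rewrite 1 [h2]; exact inv_mul_cancel s
  have h4 := orderOf_dvd_of_pow_eq_one h3
  rw [orderOf_unit_generator hs] at h4
  exact absurd (Nat.le_of_dvd (by norm_num) h4) (by omega)

theorem mapTwo_hasType (hp : 5 ≤ p) (ht : ∀ u : (ZMod p)ˣ, u ∈ Subgroup.zpowers t)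
    (j : (ZMod (p - 1))ˣ) : (mapTwo p t j).HasType
      (p * orderOf (-(t ^ (j : ZMod (p - 1)).val))) (p * (p - 1)) := by
  obtain ⟨E, ha, hb⟩ := mapTwo_isomorphic hp ht j
  have hs := unit_generator_pow ht j
  have h := algebraicMap_hasType (GroupTwo.gen p t .w *
    GroupTwo.gen p t .g ^ (j : ZMod (p - 1)).val) (GroupTwo.gen p t .c *
    GroupTwo.gen p t .g ^ ((p - 1) / 2))
  rw [← E.orderOf_eq, ← E.orderOf_eq, map_mul, ha, hb,
    MatTwo.orderOf_xu _ (orderOf_unit_generator hs), MatTwo.orderOf_face hp _ (by simp [MatTwo.flip])]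
    at h
  rw [MatTwo.mul_u, MatTwo.flip, mul_neg_one] at h
  exact h

theorem orderOf_neg_unit_generator (hp : 5 ≤ p) {s : (ZMod p)ˣ}
    (hs : ∀ u : (ZMod p)ˣ, u ∈ Subgroup.zpowers s) :
    orderOf (-s) = (p - 1) / (p - 1).gcd ((p - 1) / 2 + 1) := by
  -- The value of `p` modulo 4 enters through the greatest common divisor of this exponent with `p -
  -- 1`.
  have h : -s = s ^ ((p - 1) / 2 + 1) := by
    rw [pow_succ, unit_generator_pow_half hp hs, neg_one_mul]
  rw [h, orderOf_pow, orderOf_unit_generator hs]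

theorem mapTwo_hasType_of_mod_four_eq_one (hp : 5 ≤ p)
    (ht : ∀ u : (ZMod p)ˣ, u ∈ Subgroup.zpowers t) (j : (ZMod (p - 1))ˣ) (h4 : p % 4 = 1) :
    (mapTwo p t j).HasType (p * (p - 1)) (p * (p - 1)) := by
  have h := mapTwo_hasType hp ht j
  rw [orderOf_neg_unit_generator hp (unit_generator_pow ht j)] at h
  have hg : (p - 1).gcd ((p - 1) / 2 + 1) = 1 := by
    obtain ⟨k, rfl⟩ : ∃ k, p = 4 * k + 1 := ⟨p / 4, by omega⟩
    rw [show 4 * k + 1 - 1 = 4 * k by omega, show 4 * k / 2 + 1 = 2 * k + 1 by omega]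
    change Nat.Coprime _ _
    have h1 : Nat.Coprime (2 * k) (2 * k + 1) := by simp
    rw [show 4 * k = 2 * (2 * k) by ring]
    exact Nat.Coprime.mul_left (by simp) h1
  rwa [hg, Nat.div_one] at h

theorem mapTwo_hasType_of_mod_four_eq_three (hp : 5 ≤ p)
    (ht : ∀ u : (ZMod p)ˣ, u ∈ Subgroup.zpowers t) (j : (ZMod (p - 1))ˣ) (h4 : p % 4 = 3) :
    (mapTwo p t j).HasType (p * (p - 1) / 2) (p * (p - 1)) := by
  have h := mapTwo_hasType hp ht j
  rw [orderOf_neg_unit_generator hp (unit_generator_pow ht j)] at h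
  have hg : (p - 1).gcd ((p - 1) / 2 + 1) = 2 := by
    obtain ⟨k, rfl⟩ : ∃ k, p = 4 * k + 3 := ⟨p / 4, by omega⟩
    rw [show 4 * k + 3 - 1 = 2 * (2 * k + 1) by omega,
      show 2 * (2 * k + 1) / 2 + 1 = 2 * (k + 1) by omega, Nat.gcd_mul_left]
    have h1 : Nat.Coprime (2 * k + 1) (k + 1) := by
      rw [show 2 * k + 1 = k + (k + 1) by ring]
      simp
    rw [h1]
  rwa [hg, ← Nat.mul_div_assoc p (by omega : 2 ∣ p - 1)] at h

theorem exists_embedding_isomorphic_mapTwo (hp : 5 ≤ p)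
    (ht : ∀ u : (ZMod p)ˣ, u ∈ Subgroup.zpowers t) (j : (ZMod (p - 1))ˣ) :
    ∃ E : OrientedEmbedding (SimpleGraph.completeEquipartiteGraph p p),
      E.IsOrientablyRegular ∧ E.toArcMap.Isomorphic (mapTwo p t j) := by
  have hs := unit_generator_pow ht j
  obtain ⟨E, ha, hb⟩ := mapTwo_isomorphic hp ht j
  refine ⟨MatTwo.embedding hs, MatTwo.embedding_isOrientablyRegular hs, ?_⟩
  refine (MatTwo.embedding_isomorphic hs).trans ?_
  rw [← ha, ← hb]
  exact (algebraicMap_isomorphic_map E _ _).symm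

end MapTwo

/-! ### Companion matrices of order `p` modulo a power of `p`. -/

/-- Let `p ≥ 5`. If a companion matrix has order `p` modulo `p ^ e`, then `e = 1` and its
characteristic polynomial is `(X - 1) ^ 2` modulo `p`. -/
theorem companion_pow_prime_eq_one {p e : ℕ} (hp : p.Prime) (hp5 : 5 ≤ p) (he : 1 ≤ e) {α β : ℤ}
    (h : ∀ i j, ((p ^ e : ℕ) : ℤ) ∣ ((!![0, α; 1, β] ^ p : Matrix (Fin 2) (Fin 2) ℤ) - 1) i j) :
    e = 1 ∧ (p : ℤ) ∣ α + 1 ∧ (p : ℤ) ∣ β - 2 := by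
  have := Fact.mk hp
  set M : Matrix (Fin 2) (Fin 2) ℤ := !![0, α; 1, β] with hM
  have hmod : ∀ n : ℕ, n ∣ p ^ e → (M.map (Int.castRingHom (ZMod n))) ^ p = 1 := by
    intro n hn
    rw [← sub_eq_zero, ← RingHom.mapMatrix_apply, ← map_pow,
      ← map_one (RingHom.mapMatrix (Int.castRingHom (ZMod n))), ← map_sub]
    ext i j
    rw [RingHom.mapMatrix_apply, Matrix.map_apply]
    simp only [eq_intCast, Matrix.zero_apply]
    rw [ZMod.intCast_zmod_eq_zero_iff_dvd]
    exact (Int.natCast_dvd_natCast.mpr hn).trans (h i j)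
  have hmap : ∀ n : ℕ, M.map (Int.castRingHom (ZMod n)) =
      !![0, (α : ZMod n); 1, (β : ZMod n)] := by
    intro n
    ext i j
    fin_cases i <;> fin_cases j <;> simp [hM]
  have h1 : (p : ℤ) ∣ α + 1 ∧ (p : ℤ) ∣ β - 2 := by
    have hp1 := hmod p (dvd_pow_self p (by omega))
    rw [hmap] at hp1
    -- In characteristic `p`, `(M - 1)^p = M^p - 1 = 0`. Vanishing trace and determinant of `M - 1`
    -- give the two congruences.
    have hnil : IsNilpotent (!![0, (α : ZMod p); 1, (β : ZMod p)] - 1) := by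
      refine ⟨p, ?_⟩
      have : CharP (Matrix (Fin 2) (Fin 2) (ZMod p)) p := inferInstance
      rw [sub_pow_char_of_commute _ (Commute.one_right _), hp1, one_pow, sub_self]
    have htr := (Matrix.isNilpotent_trace_of_isNilpotent hnil).eq_zero
    have hdet : (!![0, (α : ZMod p); 1, (β : ZMod p)] - 1).det = 0 := by
      obtain ⟨k, hk⟩ := hnil
      have := congrArg Matrix.det hk
      rw [Matrix.det_pow, Matrix.det_zero] at this
      exact eq_zero_of_pow_eq_zero this
    rw [Matrix.trace_fin_two] at htr
    rw [Matrix.det_fin_two] at hdet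
    simp at htr hdet
    constructor
    · rw [← ZMod.intCast_zmod_eq_zero_iff_dvd]
      push_cast
      linear_combination -hdet - htr
    · rw [← ZMod.intCast_zmod_eq_zero_iff_dvd]
      push_cast
      linear_combination htr
  refine ⟨?_, h1⟩
  by_contra hne
  obtain ⟨⟨α', hα⟩, ⟨β', hβ⟩⟩ := h1
  have hp2 := hmod (p ^ 2) (pow_dvd_pow p (by omega))
  rw [hmap] at hp2
  set N : Matrix (Fin 2) (Fin 2) (ZMod (p ^ 2)) := !![-1, (α : ZMod (p ^ 2)); 1, β - 1] with hN
  have hpp : (p : ZMod (p ^ 2)) * p = 0 := by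
    rw [← Nat.cast_mul, ← sq]; exact ZMod.natCast_self _
  have hα' : (α : ZMod (p ^ 2)) = p * α' - 1 := by
    have := congrArg (Int.cast : ℤ → ZMod (p ^ 2)) hα
    push_cast at this
    linear_combination this
  have hβ' : (β : ZMod (p ^ 2)) = p * β' + 2 := by
    have := congrArg (Int.cast : ℤ → ZMod (p ^ 2)) hβ
    push_cast at this
    linear_combination this
  have hN2 : ∃ L : Matrix (Fin 2) (Fin 2) (ZMod (p ^ 2)), N * N = (p : ZMod (p ^ 2)) • L := by
    -- By Cayley–Hamilton, `N^2 = p (β' N + (α' + β'))`, since `p` divides both trace and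
    -- determinant of `N = M - 1`.
    refine ⟨!![(α' : ZMod (p ^ 2)), (p * α' - 1) * β'; β', α' + 2 * β' + p * β' * β'], ?_⟩
    ext i j
    fin_cases i <;> fin_cases j <;> simp [hN, Matrix.mul_apply, hα', hβ'] <;> ring
  obtain ⟨L, hL⟩ := hN2
  have hpN2 : (p : ZMod (p ^ 2)) • (N * N) = 0 := by rw [hL, smul_smul, hpp, zero_smul]
  have hN4 : N ^ 4 = 0 := by
    rw [show N ^ 4 = N * N * (N * N) by noncomm_ring, hL, smul_mul_smul_comm, hpp, zero_smul]
  have hMN : !![0, (α : ZMod (p ^ 2)); 1, (β : ZMod (p ^ 2))] = N + 1 := by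
    ext i j
    fin_cases i <;> fin_cases j <;> simp [hN]
  -- Only `1 + p N` survives in the expansion of `(N + 1)^p`: for `2 ≤ k < p` the binomial
  -- coefficient is divisible by `p` and `p N^2 = 0`, while the last term vanishes by `N^4 = 0` and
  -- `p ≥ 4`. But `p N ≠ 0`, since `N` has an entry 1.
  rw [hMN, (Commute.one_right N).add_pow, Finset.sum_eq_add_of_mem 0 1 (by simp) (by simp; omega)
    (by norm_num)] at hp2
  · simp only [pow_zero, one_pow, Nat.choose_zero_right, Nat.choose_one_right, pow_one, mul_one,
      Nat.cast_one, add_eq_left] at hp2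
    have h10 := congrFun (congrFun hp2 1) 0
    rw [← nsmul_eq_mul', Matrix.smul_apply] at h10
    simp [hN] at h10
    rw [ZMod.natCast_eq_zero_iff] at h10
    have := Nat.le_of_dvd (by omega) h10
    nlinarith
  · intro k hk hk'
    rw [Finset.mem_range] at hk
    rw [one_pow, mul_one, ← nsmul_eq_mul']
    have hN2k : N ^ k = N * N * N ^ (k - 2) := by
      rw [← sq, ← pow_add]; congr 1; omega
    rcases Nat.lt_or_ge k p with hkp | hkp
    · obtain ⟨m, hm⟩ := hp.dvd_choose_self hk'.1 hkp
      rw [hm, mul_comm, mul_smul, hN2k, ← smul_mul_assoc, ← Nat.cast_smul_eq_nsmul (ZMod (p ^ 2)) p,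
        hpN2, zero_mul, smul_zero]
    · rw [show k = 4 + (k - 4) by omega, pow_add, hN4, zero_mul, smul_zero]

/-! ### Automorphisms of a Heisenberg group induced by conjugation. -/

section HeisenbergRelations

variable {G : Type*} [Group G] {w z c : G}

theorem zpow_mul_zpow_of_conj (hwz : Commute w z) (hwc : w * c = c * (w * z)) (hzc : Commute z c)
    (i s : ℤ) : w ^ i * c ^ s = c ^ s * (w ^ i * z ^ (s * i)) := by
  have h0 : SemiconjBy w (c * z⁻¹) c := by
    change w * (c * z⁻¹) = c * w
    rw [← mul_assoc, hwc]; simp [mul_assoc]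
  have h1 : SemiconjBy (c ^ s) (w * z ^ s) w := by
    have h := h0.zpow_right s
    rw [hzc.symm.inv_right.mul_zpow, inv_zpow'] at h
    change c ^ s * (w * z ^ s) = w * c ^ s
    rw [← mul_assoc, ← h.eq, mul_assoc, mul_assoc, ← zpow_add]
    simp
  have h3 := h1.zpow_right i
  rw [(hwz.zpow_right s).mul_zpow, ← zpow_mul] at h3
  exact h3.eq.symm

variable {γ ι : G} {p : ℕ}

/-- If an involution `ι` that inverts `c` commutes with `γ`, then the conjugate of `c` by `γ` has
no component in `w`, because it is inverted by `ι`. -/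
theorem dvd_of_inverted_conj (hp2 : p.Coprime 2) (hwz : Commute w z)
    (hwc : w * c = c * (w * z)) (hzc : Commute z c)
    (hfree : ∀ i k : ℤ, w ^ i * z ^ k = 1 → (p : ℤ) ∣ i ∧ (p : ℤ) ∣ k)
    (hιw : Commute ι w) (hιγ : Commute ι γ) (hιc : ι⁻¹ * c * ι = c⁻¹)
    {s l k : ℤ} (hc : γ⁻¹ * c * γ = c ^ s * (w ^ l * z ^ k)) : (p : ℤ) ∣ l := by
  -- As `z` measures the failure of `w` and `c` to commute, inverting `c` while fixing `w` inverts
  -- `z`.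
  have hιz : ι⁻¹ * z * ι = z⁻¹ := by
    have h1 := congrArg (fun u => ι⁻¹ * u * ι) hwc
    have h2 : ι⁻¹ * (w * c) * ι = (ι⁻¹ * w * ι) * (ι⁻¹ * c * ι) := by group
    have h3 : ι⁻¹ * (c * (w * z)) * ι = (ι⁻¹ * c * ι) * ((ι⁻¹ * w * ι) * (ι⁻¹ * z * ι)) := by group
    have h4 : ι⁻¹ * w * ι = w := by rw [mul_assoc, ← hιw.eq, inv_mul_cancel_left]
    simp only [h2, h3, h4, hιc] at h1
    have h5 := zpow_mul_zpow_of_conj hwz hwc hzc 1 (-1)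
    simp only [zpow_one, zpow_neg_one, mul_one] at h5
    rw [h5] at h1
    exact (mul_left_cancel (mul_left_cancel h1)).symm
  have h1 : ι⁻¹ * (γ⁻¹ * c * γ) * ι = (γ⁻¹ * c * γ)⁻¹ := by
    have h2 : ι⁻¹ * (γ⁻¹ * c * γ) * ι = (γ * ι)⁻¹ * c * (γ * ι) := by group
    have h3 : (ι * γ)⁻¹ * c * (ι * γ) = γ⁻¹ * (ι⁻¹ * c * ι) * γ := by group
    rw [h2, ← hιγ.eq, h3, hιc]; group
  have h2 : ι⁻¹ * (c ^ s * (w ^ l * z ^ k)) * ι = (c⁻¹) ^ s * (w ^ l * (z⁻¹) ^ k) := by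
    have h3 : ∀ u : G, ι⁻¹ * u * ι = MulAut.conj ι⁻¹ u := fun u => by simp
    have h4 : ι⁻¹ * w * ι = w := by rw [mul_assoc, ← hιw.eq, inv_mul_cancel_left]
    rw [h3, map_mul, map_mul, map_zpow, map_zpow, map_zpow, ← h3, ← h3, ← h3, hιc, hιz, h4]
  rw [hc, h2, eq_inv_iff_mul_eq_one, inv_zpow', inv_zpow'] at h1
  have h3 := zpow_mul_zpow_of_conj hwz hwc hzc l s
  -- The two factors are the image under `ι` and the element itself, whose product must be 1. The
  -- powers of `c` cancel, but those of `w` add up to `2 * l`.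
  have h4 : c ^ (-s) * (w ^ l * z ^ (-k)) * (c ^ s * (w ^ l * z ^ k)) =
      w ^ (2 * l) * z ^ (s * l) := by
    have h5 : z ^ (-k) * c ^ s = c ^ s * z ^ (-k) := (hzc.zpow_zpow _ _).eq
    have h6 : z ^ (-k) * w ^ l = w ^ l * z ^ (-k) := (hwz.symm.zpow_zpow _ _).eq
    have h7 : z ^ (s * l) * w ^ l = w ^ l * z ^ (s * l) := (hwz.symm.zpow_zpow _ _).eq
    calc _ = c ^ (-s) * (w ^ l * ((z ^ (-k) * c ^ s) * (w ^ l * z ^ k))) := by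
          simp only [mul_assoc]
      _ = c ^ (-s) * ((w ^ l * c ^ s) * ((z ^ (-k) * w ^ l) * z ^ k)) := by
          rw [h5]; simp only [mul_assoc]
      _ = w ^ l * (z ^ (s * l) * w ^ l) := by
          rw [h6, h3]; simp only [mul_assoc, zpow_neg]; simp
      _ = _ := by rw [h7, ← mul_assoc, ← zpow_add, two_mul]
  rw [h4] at h1
  have h5 := (hfree _ _ h1).1
  exact (Nat.isCoprime_iff_coprime.mpr hp2).dvd_of_dvd_mul_left h5

/-- On the commuting pair `c, z` the element `γ` acts as a triangular matrix with both eigenvalues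
`s`; this is the power of that matrix. -/
theorem conj_pow_eq_of_conj (hzc : Commute z c) {s k : ℤ} (hc : γ⁻¹ * c * γ = c ^ s * z ^ k)
    (hz : γ⁻¹ * z * γ = z ^ s) (m : ℕ) :
    (γ ^ (m + 1))⁻¹ * c * γ ^ (m + 1) = c ^ (s ^ (m + 1)) * z ^ (k * (m + 1) * s ^ m) := by
  induction m with
  | zero => simpa using hc
  | succ m ih =>
    have h1 : (γ ^ (m + 1 + 1))⁻¹ * c * γ ^ (m + 1 + 1) =
        γ⁻¹ * ((γ ^ (m + 1))⁻¹ * c * γ ^ (m + 1)) * γ := by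
      rw [pow_succ γ (m + 1)]; group
    have h3 : ∀ u : G, γ⁻¹ * u * γ = MulAut.conj γ⁻¹ u := fun u => by simp
    rw [h1, ih, h3, map_mul, map_zpow, map_zpow, ← h3, ← h3, hc, hz,
      (hzc.symm.zpow_zpow s k).mul_zpow, ← zpow_mul, ← zpow_mul, ← zpow_mul, mul_assoc, ← zpow_add]
    congr 2 <;> (push_cast; ring)

theorem zpow_eq_zpow_of_dvd_sub {u : G} (hu : u ^ p = 1) {i k : ℤ} (h : (p : ℤ) ∣ i - k) :
    u ^ i = u ^ k := by
  obtain ⟨m, hm⟩ := h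
  rw [show i = p * m + k by omega, zpow_add, zpow_mul, zpow_natCast, hu, one_zpow, one_mul]

/-- A triangular matrix with equal eigenvalues and order prime to `p` is scalar. Concretely, the
off-diagonal exponent for `γ^(p-1) = 1` is `k (p - 1) s^(p-2)`, so `p` divides `k`. -/
theorem conj_eq_pow_of_conj [Fact p.Prime] (hp3 : 3 ≤ p) (hγ : γ ^ (p - 1) = 1) (hcp : c ^ p = 1)
    (hzp : z ^ p = 1) (hzc : Commute z c) (hz1 : ∀ k : ℤ, z ^ k = 1 → (p : ℤ) ∣ k) {s k : ℤ}
    (hc : γ⁻¹ * c * γ = c ^ s * z ^ k) (hz : γ⁻¹ * z * γ = z ^ s) :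
    γ⁻¹ * c * γ = c ^ s ∧ ¬ (p : ℤ) ∣ s := by
  have hp : Prime (p : ℤ) := Nat.prime_iff_prime_int.mp Fact.out
  have hs : ¬ (p : ℤ) ∣ s := by
    intro h
    have h1 : z ^ s = z ^ (0 : ℤ) := zpow_eq_zpow_of_dvd_sub hzp (by simpa using h)
    rw [h1, zpow_zero] at hz
    have h2 : z = 1 := by
      have : γ⁻¹ * z * γ * γ⁻¹ = γ⁻¹ := by rw [hz, one_mul]
      simpa using this
    have h3 := hz1 1 (by rw [h2, one_zpow])
    exact hp.not_isUnit (isUnit_of_dvd_one h3)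
  refine ⟨?_, hs⟩
  have h1 := conj_pow_eq_of_conj hzc hc hz (p - 2)
  have h2 : (p : ℤ) ∣ s ^ (p - 1) - 1 := by
    rw [← ZMod.intCast_zmod_eq_zero_iff_dvd]
    push_cast
    rw [ZMod.pow_card_sub_one_eq_one, sub_self]
    rwa [Ne, ZMod.intCast_zmod_eq_zero_iff_dvd]
  rw [show p - 2 + 1 = p - 1 by omega, hγ, zpow_eq_zpow_of_dvd_sub hcp h2] at h1
  simp only [inv_one, one_mul, mul_one, zpow_one, left_eq_mul] at h1
  have h3 := hz1 _ h1
  have h4 : ¬ (p : ℤ) ∣ ((p - 2 : ℕ) : ℤ) + 1 := by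
    intro h
    have := Int.le_of_dvd (by omega) h
    omega
  have h5 : (p : ℤ) ∣ k := by
    rcases hp.dvd_or_dvd h3 with h | h
    · exact (hp.dvd_or_dvd h).resolve_right h4
    · exact absurd (hp.dvd_of_dvd_pow h) hs
  have h6 : z ^ k = z ^ (0 : ℤ) := zpow_eq_zpow_of_dvd_sub hzp (by simpa using h5)
  rw [hc, h6, zpow_zero, mul_one]

/-- Up to the order of the factors `z` is the commutator of `w` and `c`, and `γ` centralizes `w`; so
`z` is raised to the same power as `c`. -/
theorem conj_central_eq_zpow (hwz : Commute w z) (hwc : w * c = c * (w * z)) (hzc : Commute z c)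
    (hγw : Commute γ w) {s l k : ℤ} (hc : γ⁻¹ * c * γ = c ^ s * (w ^ l * z ^ k)) :
    γ⁻¹ * z * γ = z ^ s := by
  have h1 := congrArg (fun u => γ⁻¹ * u * γ) hwc
  have h2 : γ⁻¹ * (w * c) * γ = (γ⁻¹ * w * γ) * (γ⁻¹ * c * γ) := by group
  have h3 : γ⁻¹ * (c * (w * z)) * γ = (γ⁻¹ * c * γ) * ((γ⁻¹ * w * γ) * (γ⁻¹ * z * γ)) := by group
  have h4 : γ⁻¹ * w * γ = w := by rw [mul_assoc, ← hγw.eq, inv_mul_cancel_left]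
  have h5 := zpow_mul_zpow_of_conj hwz hwc hzc 1 s
  simp only [zpow_one, mul_one] at h5
  have h6 : Commute (w ^ l * z ^ k) (w * z ^ s) :=
    ((((Commute.refl w).zpow_left l).mul_left (hwz.symm.zpow_left k)).mul_right
      (((hwz.zpow_left l).zpow_right s).mul_left ((Commute.refl z).zpow_zpow k s)))
  simp only [h2, h3, h4, hc] at h1
  rw [← mul_assoc w, h5, mul_assoc, ← h6.eq, ← mul_assoc] at h1
  exact (mul_left_cancel (mul_left_cancel h1)).symm

end HeisenbergRelations

/-! ### Recognition of `GroupTwo p t` from its generating pair. -/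

/-- A group generated by `a` and an involution `b` that satisfy the relations of a Heisenberg group
extended by a cyclic group of order `p - 1` is `GroupTwo p t`. -/
theorem exists_mulEquiv_groupTwo {G : Type*} [Group G] [Finite G] {p : ℕ} [Fact p.Prime]
    (hp5 : 5 ≤ p) {t : (ZMod p)ˣ} (ht : ∀ u : (ZMod p)ˣ, u ∈ Subgroup.zpowers t) {a b x y c : G}
    (hcard : Nat.card G = p * p * (p * (p - 1))) (hgen : Subgroup.closure {a, b} = ⊤)
    (hb : b * b = 1) (ha : orderOf a = p * (p - 1)) (hx : x = a ^ (p - 1)) (hy : y = b * x * b)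
    (hc : c = b * (a ^ p) ^ ((p - 1) / 2)) (hxy : Commute x y)
    (hfree : ∀ m n : ℤ, x ^ m * y ^ n = 1 → (p : ℤ) ∣ m ∧ (p : ℤ) ∣ n)
    (hcp : c ^ p = 1) (hcy : c * y * c⁻¹ = x⁻¹ * y ^ 2)
    (hconj : ∃ s : ℕ, ∃ m n : ℤ, (a ^ p)⁻¹ * c * a ^ p = c ^ s * (x ^ m * y ^ n))
    (hcore : ∀ k : ℕ, Commute (a ^ k) b → a ^ k = 1) :
    ∃ j : (ZMod (p - 1))ˣ, ∃ Θ : GroupTwo p t ≃* G,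
      Θ (GroupTwo.gen p t .w * GroupTwo.gen p t .g ^ (j : ZMod (p - 1)).val) = a ∧
      Θ (GroupTwo.gen p t .c * GroupTwo.gen p t .g ^ ((p - 1) / 2)) = b := by
  have hp : p.Prime := Fact.out
  have hodd : p % 2 = 1 := hp.eq_two_or_odd.resolve_left (by omega)
  have hax : Commute a x := by rw [hx]; exact (Commute.refl a).pow_right _
  have hxp : x ^ p = 1 := by
    rw [hx, ← pow_mul, mul_comm, ← ha, pow_orderOf_eq_one]
  have hyp : y ^ p = 1 := by
    have h : y = b * x * b⁻¹ := by rw [hy, inv_eq_of_mul_eq_one_right hb]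
    rw [h, conj_pow, hxp]; simp
  set γ := a ^ p with hγ
  set n := (p - 1) / 2 with hn
  set ι := γ ^ n with hι
  set w := x⁻¹ with hw
  -- The element `x⁻¹ y` spans the eigenspace of `c` acting on `⟨x, y⟩`, and `w = x⁻¹` completes a
  -- basis in which this action is unipotent.
  set z := x⁻¹ * y with hz
  have hn2 : n * 2 = p - 1 := by omega
  have hγp : γ ^ (p - 1) = 1 := by rw [hγ, ← pow_mul, ← ha, pow_orderOf_eq_one]
  have hγo : orderOf γ = p - 1 := by
    rw [hγ, orderOf_pow, ha, Nat.gcd_eq_right (dvd_mul_right _ _), Nat.mul_div_cancel_left _ hp.pos]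
  have hγw : Commute γ w := (hax.pow_left p).inv_right
  have hιγ : Commute ι γ := (Commute.refl γ).pow_left n
  have hιw : Commute ι w := hγw.pow_left n
  have hιι : ι * ι = 1 := by rw [hι, ← sq, ← pow_mul, hn2, hγp]
  have hι' : ι⁻¹ = ι := inv_eq_of_mul_eq_one_right hιι
  have hb' : b⁻¹ = b := inv_eq_of_mul_eq_one_right hb
  have hbc : b = c * ι := by rw [hc, mul_assoc, hιι, mul_one]
  have haw : a = w * γ := by
    rw [hw, hx, hγ, eq_inv_mul_iff_mul_eq, ← pow_succ, Nat.sub_add_cancel hp.one_le]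
  have hιc : ι⁻¹ * c * ι = c⁻¹ := by
    rw [hc, mul_inv_rev, hι', hb', mul_assoc, mul_assoc, hιι, mul_one]
  have hcx : c * x * c⁻¹ = y := by
    have h : Commute ι x := (hax.pow_left p).pow_left n
    rw [hc, mul_inv_rev, hb', hy]
    calc b * ι * x * (ι⁻¹ * b) = b * (ι * x) * ι⁻¹ * b := by simp only [mul_assoc]
      _ = b * x * b := by rw [h.eq]; simp only [mul_assoc, mul_inv_cancel_left]
  have hwz : Commute w z := ((Commute.refl x).inv_right.mul_right hxy).inv_left
  have hwp : w ^ p = 1 := by rw [hw, inv_pow, hxp, inv_one]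
  have hzp : z ^ p = 1 := by rw [hz, hxy.inv_left.mul_pow, inv_pow, hxp, hyp]; simp
  have hcinv : ∀ u : G, c * u * c⁻¹ = MulAut.conj c u := fun u => rfl
  have hwc : w * c = c * (w * z) := by
    have h : c * (w * z) * c⁻¹ = w := by
      have h1 : w * (y * y) = y * y * w := (hxy.inv_left.mul_right hxy.inv_left).eq
      rw [hcinv, hz, hw, map_mul, map_mul, map_inv, ← hcinv, ← hcinv, hcx, hcy, sq, ← mul_assoc,
        ← mul_assoc, mul_assoc (y⁻¹ * y⁻¹), h1]
      simp only [mul_assoc, inv_mul_cancel_left]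
      exact hw
    exact (mul_inv_eq_iff_eq_mul.mp h).symm
  have hzc : Commute z c := by
    have h : c * z * c⁻¹ = z := by
      rw [hcinv, hz, map_mul, map_inv, ← hcinv, ← hcinv, hcx, hcy, sq, ← mul_assoc, ← mul_assoc,
        hxy.inv_left.symm.inv_left.eq]
      simp [mul_assoc]
    exact (mul_inv_eq_iff_eq_mul.mp h).symm
  have hfreewz : ∀ i k : ℤ, w ^ i * z ^ k = 1 → (p : ℤ) ∣ i ∧ (p : ℤ) ∣ k := by
    intro i k h
    rw [hz, hxy.inv_left.mul_zpow, ← mul_assoc, hw, ← zpow_add, inv_zpow'] at h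
    obtain ⟨h1, h2⟩ := hfree _ _ h
    exact ⟨by have := dvd_sub (h1.neg_right) h2; simpa using this, h2⟩
  have hz1 : ∀ k : ℤ, z ^ k = 1 → (p : ℤ) ∣ k := fun k hk => (hfreewz 0 k (by simpa using hk)).2
  obtain ⟨s, l, k, hcγ⟩ : ∃ s : ℕ, ∃ l k : ℤ, γ⁻¹ * c * γ = c ^ (s : ℤ) * (w ^ l * z ^ k) := by
    obtain ⟨s, m, n, h⟩ := hconj
    -- Change of basis: `x^m y^n = w^(-m-n) z^n`.
    refine ⟨s, -m - n, n, ?_⟩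
    rw [h, zpow_natCast, hz, hxy.inv_left.mul_zpow, ← mul_assoc (w ^ _), hw, ← zpow_add, inv_zpow']
    congr 3; ring
  have hl : (p : ℤ) ∣ l := dvd_of_inverted_conj (by simpa using Nat.odd_iff.mpr hodd) hwz hwc hzc
    hfreewz hιw hιγ hιc hcγ
  have hzγ : γ⁻¹ * z * γ = z ^ (s : ℤ) := conj_central_eq_zpow hwz hwc hzc hγw hcγ
  have hl0 : w ^ l = w ^ (0 : ℤ) := zpow_eq_zpow_of_dvd_sub hwp (by simpa using hl)
  rw [hl0, zpow_zero, one_mul] at hcγ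
  obtain ⟨hcγ', hps⟩ := conj_eq_pow_of_conj (by omega) hγp hcp hzp hzc hz1 hcγ hzγ
  have hconjc : ∀ m : ℕ, (γ ^ m)⁻¹ * c * γ ^ m = c ^ (s ^ m) := by
    intro m
    cases m with
    | zero => simp
    | succ m =>
      have := conj_pow_eq_of_conj (k := 0) hzc (by simpa using hcγ') hzγ m
      simpa [← zpow_natCast] using this
  have hconjz : ∀ m : ℕ, (γ ^ m)⁻¹ * z * γ ^ m = z ^ (s ^ m) := by
    intro m
    cases m with
    | zero => simp
    | succ m =>
      have := conj_pow_eq_of_conj (k := 0) (Commute.refl z) (by simpa using hzγ) hzγ m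
      simpa [← zpow_natCast] using this
  have hcop : s.Coprime p := by
    rw [Nat.coprime_comm, hp.coprime_iff_not_dvd]
    exact_mod_cast hps
  obtain ⟨σ, hσ⟩ : ∃ σ : (ZMod p)ˣ, (σ : ZMod p) = s :=
    ⟨ZMod.unitOfCoprime s hcop, ZMod.coe_unitOfCoprime s hcop⟩
  have hmodp : ∀ {u : G} {i k : ℕ}, u ^ p = 1 → (i : ZMod p) = k → u ^ i = u ^ k := by
    intro u i k hu h
    rw [pow_eq_pow_mod i hu, pow_eq_pow_mod k hu, (ZMod.natCast_eq_natCast_iff' _ _ _).mp h]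
  -- The action of `γ` on `c` is faithful: a power of `γ` commuting with `c` commutes with `b = c
  -- ι`, and is trivial by core-freeness.
  have hσo : orderOf σ = p - 1 := by
    refine Nat.dvd_antisymm (orderOf_dvd_of_pow_eq_one (ZMod.units_pow_card_sub_one_eq_one _ _)) ?_
    rw [← hγo]
    apply orderOf_dvd_of_pow_eq_one
    set m := orderOf σ with hm
    have h1 : c ^ (s ^ m) = c := by
      have h := congrArg (Units.val) (pow_orderOf_eq_one σ)
      rw [Units.val_pow_eq_pow_val, hσ] at h
      exact (hmodp (k := 1) hcp (by simpa using h)).trans (pow_one c)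
    have h2 := hconjc m
    rw [h1, mul_assoc, inv_mul_eq_iff_eq_mul] at h2
    rw [hγ, ← pow_mul]
    apply hcore
    rw [pow_mul, ← hγ, hbc]
    exact Commute.mul_right h2.symm (((Commute.refl γ).pow_left m).pow_right n)
  have hσg : ∀ u : (ZMod p)ˣ, u ∈ Subgroup.zpowers σ := by
    have h : Subgroup.zpowers σ = ⊤ := Subgroup.eq_top_of_card_eq _ (by
      rw [Nat.card_zpowers, hσo, Nat.card_eq_fintype_card, ZMod.card_units_eq_totient,
        Nat.totient_prime hp])
    exact fun u => h ▸ Subgroup.mem_top u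
  -- The element `γ` acts with exponent `σ`, so `g = γ^i` acts with the prescribed exponent `t`, and
  -- `j` is the inverse of `i` modulo `p - 1`.
  obtain ⟨i, hi⟩ : ∃ i : ℕ, σ ^ i = t := mem_powers_iff_mem_zpowers.mpr (hσg t)
  obtain ⟨j₀, hj₀⟩ : ∃ j : ℕ, t ^ j = σ := mem_powers_iff_mem_zpowers.mpr (ht σ)
  have hij : i * j₀ ≡ 1 [MOD p - 1] := by
    rw [← hσo, ← pow_eq_pow_iff_modEq, pow_mul, hi, hj₀, pow_one]
  -- Oddness of `i` ensures that `g` and `γ` have the same involution as their `(p-1)/2`-th power.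
  have hiodd : i % 2 = 1 := by
    have h : i * j₀ ≡ 1 [MOD 2] := hij.of_dvd (by omega)
    rcases Nat.mod_two_eq_zero_or_one i with h0 | h0
    · have := h.symm.trans (Nat.ModEq.mul_right j₀ (show i ≡ 0 [MOD 2] from h0))
      rw [zero_mul] at this
      exact absurd this (by decide)
    · exact h0
  have : NeZero (p - 1) := ⟨by omega⟩
  have hij' : (j₀ : ZMod (p - 1)) * i = 1 := by
    have := (ZMod.natCast_eq_natCast_iff _ _ _).mpr hij
    push_cast at this
    rw [mul_comm]; exact this
  set j : (ZMod (p - 1))ˣ := Units.mkOfMulEqOne _ _ hij' with hj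
  set g := γ ^ i with hg
  have hsi : ((s ^ i : ℕ) : ZMod p) = ((t : ZMod p).val : ℕ) := by
    rw [ZMod.natCast_zmod_val, ← hi]; push_cast; rw [hσ]
  have hgj : g ^ (j : ZMod (p - 1)).val = γ := by
    have h : i * (j : ZMod (p - 1)).val ≡ 1 [MOD p - 1] := by
      rw [← ZMod.natCast_eq_natCast_iff]
      push_cast
      rw [ZMod.natCast_zmod_val, mul_comm]
      exact hij'
    rw [hg, ← pow_mul]
    conv_rhs => rw [← pow_one γ]
    rw [pow_eq_pow_iff_modEq, hγo]
    exact h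
  have hgn : g ^ n = ι := by
    obtain ⟨r, hr⟩ : ∃ r, i = 2 * r + 1 := ⟨i / 2, by omega⟩
    rw [hg, ← pow_mul, hr, show (2 * r + 1) * n = (n * 2) * r + n by ring, pow_add, pow_mul, hn2,
      hγp, one_pow, one_mul]
  let f : GenTwo → G := fun
    | .w => w
    | .z => z
    | .c => c
    | .g => g
  have hrel := lift_eq_one_of_relTwo (p := p) (t := t) (f := f) hwp hzp hcp
    (by change (γ ^ i) ^ (p - 1) = 1; rw [← pow_mul, mul_comm, pow_mul, hγp, one_pow])
    hwz (by
      change c * g = g * c ^ _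
      rw [← hmodp hcp hsi, ← hconjc i, ← hg]; group) hwc hzc (hγw.pow_left i).symm
    (by
      change z * g = g * z ^ _
      rw [← hmodp hzp hsi, ← hconjz i, ← hg]; group)
  set Θ : GroupTwo p t →* G := PresentedGroup.toGroup hrel with hΘ
  have hΘs : ∀ s, Θ (GroupTwo.gen p t s) = f s := fun s => PresentedGroup.toGroup.of _
  have hΘa : Θ (GroupTwo.gen p t .w * GroupTwo.gen p t .g ^ (j : ZMod (p - 1)).val) = a := by
    rw [map_mul, map_pow, hΘs, hΘs]
    change w * g ^ _ = a
    rw [hgj, haw]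
  have hΘb : Θ (GroupTwo.gen p t .c * GroupTwo.gen p t .g ^ ((p - 1) / 2)) = b := by
    rw [map_mul, map_pow, hΘs, hΘs]
    change c * g ^ n = b
    rw [hgn, hbc]
  have hsurj : Function.Surjective Θ := by
    rw [← MonoidHom.range_eq_top, eq_top_iff, ← hgen, Subgroup.closure_le]
    rintro u (rfl | rfl)
    · exact ⟨_, hΘa⟩
    · exact ⟨_, hΘb⟩
  have hbij : Function.Bijective Θ :=
    (Nat.bijective_iff_surjective_and_card Θ).mpr ⟨hsurj, by rw [GroupTwo.card_eq ht, hcard]⟩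
  exact ⟨j, MulEquiv.ofBijective Θ hbij, hΘa, hΘb⟩

/-! ### The generating pair of a regular embedding. -/

namespace OrientedEmbedding

variable {V : Type*} {Γ : SimpleGraph V} {M : OrientedEmbedding Γ}

/-- Evaluation at an arc is a bijection between the automorphisms and the arcs. -/
theorem IsOrientablyRegular.bijective (hM : M.IsOrientablyRegular) (d : Γ.Dart) :
    Function.Bijective fun φ : M.autPlus => onArcs φ.1 d :=
  ⟨fun _ _ h => autPlus_eq h, fun d' => (hM d d').exists⟩

variable {d : Γ.Dart} {a b : M.autPlus}

/-- Sending `φ` to the image of `d` under `φ⁻¹` turns the left action on arcs into a right one. This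
is why the generators are specified by the action of `a⁻¹` and `b⁻¹`. -/
theorem toArcMap_isomorphic_algebraicMap (hM : M.IsOrientablyRegular)
    (ha : onArcs a⁻¹.1 d = M.rotation d) (hb : onArcs b⁻¹.1 d = d.symm) :
    M.toArcMap.Isomorphic (algebraicMap a b) := by
  apply ArcMap.Isomorphic.symm
  refine ⟨(Equiv.inv M.autPlus).trans (Equiv.ofBijective _ (hM.bijective d)), fun φ => ?_,
    fun φ => ?_⟩
  · change onArcs (a * φ)⁻¹.1 d = M.rotation (onArcs φ⁻¹.1 d)
    rw [mul_inv_rev, ← φ⁻¹.2 d, ← ha]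
    rfl
  · change onArcs (b * φ)⁻¹.1 d = (onArcs φ⁻¹.1 d).symm
    rw [mul_inv_rev, ← onArcs_symm, ← hb]
    rfl

theorem onArcs_zpow (ha : onArcs a⁻¹.1 d = M.rotation d) (k : ℤ) :
    onArcs (a⁻¹ ^ k).1 d = (M.rotation ^ k) d := by
  have h1 : ∀ n : ℕ, onArcs (a⁻¹ ^ n).1 d = (M.rotation ^ n) d := by
    intro n
    induction n with
    | zero => rfl
    | succ n ih =>
      rw [pow_succ, pow_succ, Equiv.Perm.mul_apply, ← ha]
      change onArcs (a⁻¹ ^ n).1 (onArcs a⁻¹.1 d) = _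
      have h := onArcs_rotation_zpow M a⁻¹ n d
      simp only [zpow_natCast] at h
      rw [← h, ← ih, ← onArcs_mul, ← onArcs_mul]
      have h2 : a⁻¹ ^ n * a⁻¹ = a⁻¹ * a⁻¹ ^ n := ((Commute.refl a⁻¹).pow_left n).eq
      exact congrArg (fun φ : M.autPlus => onArcs φ.1 d) h2
  cases k with
  | ofNat n => simpa using h1 n
  | negSucc n =>
    rw [zpow_negSucc, zpow_negSucc, Equiv.Perm.eq_inv_iff_eq]
    have h := onArcs_rotation_zpow M (a⁻¹ ^ (n + 1))⁻¹ (n + 1 : ℕ) d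
    simp only [zpow_natCast] at h
    rw [← h, ← h1]
    exact onArcs_inv_cancel _ d

theorem fst_fixed (ha : onArcs a⁻¹.1 d = M.rotation d) : a.1 d.fst = d.fst := by
  have h : a⁻¹.1 d.fst = d.fst := by
    change (onArcs a⁻¹.1 d).fst = d.fst
    rw [ha, M.fst_rotation]
  conv_lhs => rw [← h]
  exact RelIso.apply_symm_apply a.1 d.fst

theorem mem_zpowers_iff_fixes (ha : onArcs a⁻¹.1 d = M.rotation d) (φ : M.autPlus) :
    φ ∈ Subgroup.zpowers a ↔ φ.1 d.fst = d.fst := by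
  constructor
  · intro h
    rw [Subgroup.zpowers_eq_closure] at h
    induction h using Subgroup.closure_induction with
    | mem ψ hψ => rw [Set.mem_singleton_iff.mp hψ]; exact fst_fixed ha
    | one => rfl
    | mul ψ χ _ _ h1 h2 =>
      change ψ.1 (χ.1 d.fst) = _
      rw [h2, h1]
    | inv ψ _ h =>
      change ψ.1.symm d.fst = _
      conv_lhs => rw [← h]
      exact RelIso.symm_apply_apply _ _
  · intro h
    obtain ⟨k, hk⟩ := M.sameCycle d (onArcs φ.1 d) h.symm
    rw [← Subgroup.zpowers_inv]
    refine ⟨k, autPlus_eq (d := d) ?_⟩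
    change onArcs (a⁻¹ ^ k).1 d = _
    rw [onArcs_zpow ha, hk]

/-- By connectedness the subgroup generated by `a` and `b` is transitive on the orbit of the initial
vertex of `d`, and it contains the stabilizer of that vertex. -/
theorem closure_eq_top (ha : onArcs a⁻¹.1 d = M.rotation d) (hb : onArcs b.1 d = d.symm) :
    Subgroup.closure {a, b} = ⊤ := by
  set S := Subgroup.closure {a, b} with hS
  have haS : a ∈ S := Subgroup.subset_closure (by simp)
  have hbS : b ∈ S := Subgroup.subset_closure (by simp)
  have hadj : ∀ v, Γ.Adj d.fst v → ∃ φ ∈ S, φ.1 d.fst = v := by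
    intro v hv
    obtain ⟨k, hk⟩ := M.sameCycle d ⟨(d.fst, v), hv⟩ rfl
    refine ⟨a⁻¹ ^ k * b, S.mul_mem (S.zpow_mem (S.inv_mem haS) k) hbS, ?_⟩
    rw [← onArcs_zpow ha] at hk
    have h1 : b.1 d.fst = d.snd := congrArg (fun d : Γ.Dart => d.fst) hb
    change (a⁻¹ ^ k).1 (b.1 d.fst) = v
    rw [h1]
    exact congrArg (fun d : Γ.Dart => d.snd) hk
  have hall : ∀ u v, Γ.Reachable u v → (∃ φ ∈ S, φ.1 d.fst = u) → ∃ φ ∈ S, φ.1 d.fst = v := by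
    rintro u v ⟨q⟩
    induction q with
    | nil => exact id
    | cons h q ih =>
      rintro ⟨φ, hφ, rfl⟩
      apply ih
      obtain ⟨ψ, hψ, h2⟩ := hadj (φ.1.symm _) (φ.1.map_adj_iff.mp (by
        rw [RelIso.apply_symm_apply]; exact h))
      refine ⟨φ * ψ, S.mul_mem hφ hψ, ?_⟩
      change φ.1 (ψ.1 d.fst) = _
      rw [h2, RelIso.apply_symm_apply]
  rw [eq_top_iff]
  rintro φ -
  obtain ⟨ψ, hψ, h⟩ := hall _ (φ.1 d.fst) (M.connected.preconnected d.fst _) ⟨1, S.one_mem, rfl⟩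
  have h1 : ψ⁻¹ * φ ∈ Subgroup.zpowers a := by
    rw [mem_zpowers_iff_fixes ha]
    change ψ.1.symm (φ.1 d.fst) = d.fst
    rw [← h, RelIso.symm_apply_apply]
  have h2 := S.mul_mem hψ ((Subgroup.zpowers_le.mpr haS) h1)
  rwa [mul_inv_cancel_left] at h2

/-- An element of `⟨a⟩` commuting with `b` fixes both ends of the arc `d`. It plays the role of
core-freeness. -/
theorem pow_eq_one_of_commute (ha : onArcs a⁻¹.1 d = M.rotation d) (hb : onArcs b.1 d = d.symm)
    (k : ℕ) (h : Commute (a ^ k) b) : a ^ k = 1 := by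
  have h0 : (a ^ k).1 d.fst = d.fst :=
    (mem_zpowers_iff_fixes ha _).mp (Subgroup.pow_mem _ (Subgroup.mem_zpowers a) k)
  have h1 : b.1 d.fst = d.snd := congrArg (fun d : Γ.Dart => d.fst) hb
  refine M.autPlus_ext (d := d) (SimpleGraph.Dart.ext _ _ (Prod.ext h0 ?_))
  change (a ^ k).1 d.snd = d.snd
  rw [← h1]
  change (a ^ k * b).1 d.fst = _
  rw [h.eq]
  change b.1 ((a ^ k).1 d.fst) = _
  rw [h0]

theorem card_autPlus (hM : M.IsOrientablyRegular) (d : Γ.Dart) :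
    Nat.card M.autPlus = Nat.card Γ.Dart :=
  Nat.card_congr (Equiv.ofBijective _ (hM.bijective d))

theorem orderOf_eq_card_fst (hM : M.IsOrientablyRegular) (ha : onArcs a⁻¹.1 d = M.rotation d) :
    orderOf a = Nat.card {d' : Γ.Dart // d'.fst = d.fst} := by
  rw [← Nat.card_zpowers]
  exact Nat.card_congr ((Equiv.ofBijective _ (hM.bijective d)).subtypeEquiv
    (mem_zpowers_iff_fixes ha))

instance [Finite V] : Finite M.autPlus :=
  Finite.of_injective (fun φ : M.autPlus => (φ.1 : V → V)) fun _ _ h =>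
    Subtype.ext (DFunLike.coe_injective h)

end OrientedEmbedding

theorem card_dart_fst_completeEquipartiteGraph {m n : ℕ} (v : Fin m × Fin n) :
    Nat.card {d : (SimpleGraph.completeEquipartiteGraph m n).Dart // d.fst = v} = (m - 1) * n := by
  classical
  rw [← SimpleGraph.degree_completeEquipartiteGraph v, ← SimpleGraph.dart_fst_fiber_card_eq_degree,
    Nat.card_eq_fintype_card, Fintype.card_subtype]

theorem card_dart_completeEquipartiteGraph {m n : ℕ} :
    Nat.card (SimpleGraph.completeEquipartiteGraph m n).Dart = m * n * ((m - 1) * n) := by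
  classical
  rw [Nat.card_eq_fintype_card, SimpleGraph.dart_card_eq_sum_degrees]
  simp [SimpleGraph.degree_completeEquipartiteGraph]

/-! ### The action on the parts and the part-preserving subgroup. -/

section Parts

open OrientedEmbedding

variable {m n : ℕ}

theorem fst_apply_eq_iff (φ : SimpleGraph.completeEquipartiteGraph m n ≃g SimpleGraph.completeEquipartiteGraph m n) (v v' : Fin m × Fin n) :
    (φ v).1 = (φ v').1 ↔ v.1 = v'.1 := by
  have h := φ.map_adj_iff (v := v) (w := v')
  rw [SimpleGraph.completeEquipartiteGraph_adj, SimpleGraph.completeEquipartiteGraph_adj] at h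
  exact not_iff_not.mp h

variable {M : OrientedEmbedding (SimpleGraph.completeEquipartiteGraph m n)}
variable {d : (SimpleGraph.completeEquipartiteGraph m n).Dart} {a b x y : M.autPlus}

theorem fst_fst_ne (d : (SimpleGraph.completeEquipartiteGraph m n).Dart) : d.fst.1 ≠ d.snd.1 :=
  d.adj

theorem orderOf_rotation (hM : M.IsOrientablyRegular) (ha : onArcs a⁻¹.1 d = M.rotation d) :
    orderOf a = (m - 1) * n := by
  rw [orderOf_eq_card_fst hM ha, card_dart_fst_completeEquipartiteGraph]

theorem orderOf_pow_pred (hm : 3 ≤ m) (hM : M.IsOrientablyRegular)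
    (ha : onArcs a⁻¹.1 d = M.rotation d) : orderOf (a ^ (m - 1)) = n := by
  rw [orderOf_pow, orderOf_rotation hM ha, Nat.gcd_eq_right (dvd_mul_right _ _),
    Nat.mul_div_cancel_left _ (by omega)]

theorem zpow_fixes_fst (ha : onArcs a⁻¹.1 d = M.rotation d) (hx : x = a ^ (m - 1)) (k : ℤ) :
    (x ^ k).1 d.fst = d.fst :=
  (mem_zpowers_iff_fixes ha _).mp (Subgroup.zpow_mem _
    (hx ▸ Subgroup.pow_mem _ (Subgroup.mem_zpowers a) _) k)

theorem conj_zpow_fixes_snd (ha : onArcs a⁻¹.1 d = M.rotation d) (hb : onArcs b.1 d = d.symm)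
    (hbb : b * b = 1) (hx : x = a ^ (m - 1)) (hy : y = b * x * b) (k : ℤ) :
    (y ^ k).1 d.snd = d.snd := by
  have hb1 : b.1 d.fst = d.snd := congrArg
    (fun d : (SimpleGraph.completeEquipartiteGraph m n).Dart => d.fst) hb
  have hb2 : b.1 d.snd = d.fst := congrArg
    (fun d : (SimpleGraph.completeEquipartiteGraph m n).Dart => d.snd) hb
  have h : y ^ k = b * x ^ k * b := by
    have hb' : b = b⁻¹ := (inv_eq_of_mul_eq_one_right hbb).symm
    rw [hy]
    conv_lhs => rw [show b * x * b = b * x * b⁻¹ by rw [← hb']]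
    rw [conj_zpow, ← hb']
  rw [h]
  change b.1 ((x ^ k).1 (b.1 d.snd)) = _
  rw [hb2, zpow_fixes_fst ha hx, hb1]

theorem eq_of_fixes {φ ψ : M.autPlus} (h1 : φ.1 d.fst = ψ.1 d.fst) (h2 : φ.1 d.snd = ψ.1 d.snd) :
    φ = ψ :=
  autPlus_eq (d := d) (SimpleGraph.Dart.ext _ _ (Prod.ext h1 h2))

/-- The powers of `x` fix one end of `d` and those of `y` the other, so a common element fixes the
arc. -/
theorem zpow_mul_zpow_eq_one (ha : onArcs a⁻¹.1 d = M.rotation d)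
    (hb : onArcs b.1 d = d.symm) (hbb : b * b = 1) (hx : x = a ^ (m - 1)) (hy : y = b * x * b)
    (hxo : orderOf x = n) (hyo : orderOf y = n) {k l : ℤ} (h : x ^ k * y ^ l = 1) :
    (n : ℤ) ∣ k ∧ (n : ℤ) ∣ l := by
  have h1 : y ^ l = x ^ (-k) := by rw [zpow_neg]; exact eq_inv_of_mul_eq_one_right h
  have h2 : y ^ l = 1 := by
    refine eq_of_fixes (d := d) ?_ (conj_zpow_fixes_snd ha hb hbb hx hy l)
    rw [h1]
    exact zpow_fixes_fst ha hx _
  have h3 : x ^ k = 1 := by rwa [h2, mul_one] at h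
  exact ⟨hxo ▸ orderOf_dvd_iff_zpow_eq_one.mpr h3, hyo ▸ orderOf_dvd_iff_zpow_eq_one.mpr h2⟩

variable [NeZero n]

/-- The action of the graph automorphisms on the set of parts. -/
def partPerm :
    (SimpleGraph.completeEquipartiteGraph m n ≃g SimpleGraph.completeEquipartiteGraph m n) →* Equiv.Perm (Fin m) where
  toFun φ :=
    { toFun := fun i => (φ (i, 0)).1
      invFun := fun i => (φ⁻¹ (i, 0)).1
      left_inv := fun i => by
        have h : (φ⁻¹ ((φ (i, 0)).1, 0)).1 = (φ⁻¹ (φ (i, 0))).1 :=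
          (fst_apply_eq_iff φ⁻¹ _ _).mpr rfl
        change (φ⁻¹ ((φ (i, 0)).1, 0)).1 = i
        rw [h]
        exact congrArg Prod.fst (RelIso.symm_apply_apply φ (i, 0))
      right_inv := fun i => by
        have h : (φ ((φ⁻¹ (i, 0)).1, 0)).1 = (φ (φ⁻¹ (i, 0))).1 :=
          (fst_apply_eq_iff φ _ _).mpr rfl
        change (φ ((φ⁻¹ (i, 0)).1, 0)).1 = i
        rw [h]
        exact congrArg Prod.fst (RelIso.apply_symm_apply φ (i, 0)) }
  map_one' := rfl
  map_mul' φ ψ := Equiv.ext fun i => (fst_apply_eq_iff φ (ψ (i, 0)) ((ψ (i, 0)).1, 0)).mpr rfl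

theorem partPerm_apply (φ : SimpleGraph.completeEquipartiteGraph m n ≃g SimpleGraph.completeEquipartiteGraph m n) (v : Fin m × Fin n) :
    partPerm φ v.1 = (φ v).1 :=
  (fst_apply_eq_iff φ (v.1, 0) v).mpr rfl

/-- The action of the orientation-preserving automorphisms on the set of parts. -/
def autPartPerm (M : OrientedEmbedding (SimpleGraph.completeEquipartiteGraph m n)) : M.autPlus →* Equiv.Perm (Fin m) :=
  partPerm.comp M.autPlus.subtype

theorem autPartPerm_apply (φ : M.autPlus) (v : Fin m × Fin n) :
    autPartPerm M φ v.1 = (φ.1 v).1 := partPerm_apply φ.1 v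

theorem ker_autPartPerm (M : OrientedEmbedding (SimpleGraph.completeEquipartiteGraph m n)) : (autPartPerm M).ker = autPlusZero M := by
  ext φ
  rw [MonoidHom.mem_ker]
  constructor
  · intro h v
    rw [← autPartPerm_apply, h]; rfl
  · intro h
    ext i : 1
    have := autPartPerm_apply φ (i, (0 : Fin n))
    exact this.trans (h (i, 0))

/-- The generator of a vertex stabilizer permutes the parts in a cycle of length `m - 1`. -/
theorem orderOf_autPartPerm (hm : 3 ≤ m) (ha : onArcs a⁻¹.1 d = M.rotation d) :
    orderOf (autPartPerm M a) = m - 1 := by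
  classical
  have hfix : autPartPerm M a d.fst.1 = d.fst.1 := by
    rw [autPartPerm_apply, fst_fixed ha]
  have htrans : ∀ i, i ≠ d.fst.1 → (autPartPerm M a).SameCycle d.snd.1 i := by
    intro i hi
    obtain ⟨k, hk⟩ := M.sameCycle d ⟨(d.fst, (i, d.fst.2)), hi.symm⟩ rfl
    rw [← onArcs_zpow ha] at hk
    refine ⟨-k, ?_⟩
    rw [← map_zpow, zpow_neg, ← inv_zpow, autPartPerm_apply]
    exact congrArg (fun d : (SimpleGraph.completeEquipartiteGraph m n).Dart => d.snd.1) hk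
  have hmove : ∀ i, i ≠ d.fst.1 → autPartPerm M a i ≠ i := by
    intro i hi h
    -- A second fixed part would be a whole orbit, but `a` permutes the parts other than that of
    -- `d.fst` transitively, and a third part exists.
    obtain ⟨i', hi'⟩ : ∃ i', i' ∉ ({d.fst.1, i} : Finset (Fin m)) := by
      by_contra! hcon
      have h1 : (Finset.univ : Finset (Fin m)) ⊆ {d.fst.1, i} := fun j _ => hcon j
      have h2 := (Finset.card_le_card h1).trans Finset.card_le_two
      rw [Finset.card_univ, Fintype.card_fin] at h2
      omega
    simp only [Finset.mem_insert, Finset.mem_singleton, not_or] at hi'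
    obtain ⟨k, hk⟩ := (htrans i hi).symm.trans (htrans i' hi'.1)
    rw [Equiv.Perm.zpow_apply_eq_self_of_apply_eq_self h] at hk
    exact hi'.2 hk.symm
  have hcyc : (autPartPerm M a).IsCycle := by
    refine ⟨d.snd.1, hmove _ (fst_fst_ne d).symm, fun i hi => htrans i ?_⟩
    rintro rfl
    exact hi hfix
  have hsupp : (autPartPerm M a).support = {d.fst.1}ᶜ := by
    ext i
    rw [Equiv.Perm.mem_support, Finset.mem_compl, Finset.mem_singleton]
    exact ⟨fun h hi => h (hi ▸ hfix), hmove i⟩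
  rw [hcyc.orderOf, hsupp, Finset.card_compl, Finset.card_singleton, Fintype.card_fin]

theorem pow_mem_autPlusZero_iff (hm : 3 ≤ m) (ha : onArcs a⁻¹.1 d = M.rotation d) (k : ℤ) :
    a ^ k ∈ autPlusZero M ↔ ((m - 1 : ℕ) : ℤ) ∣ k := by
  rw [← ker_autPartPerm, MonoidHom.mem_ker, map_zpow, ← orderOf_dvd_iff_zpow_eq_one,
    orderOf_autPartPerm hm ha]

theorem autPlusZero_normal : (autPlusZero M).Normal := by
  rw [← ker_autPartPerm]; infer_instance

theorem mem_zpowers_of_fixes_fst (hm : 3 ≤ m) (ha : onArcs a⁻¹.1 d = M.rotation d)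
    (hx : x = a ^ (m - 1)) {φ : M.autPlus} (hφ : φ ∈ autPlusZero M) (h : φ.1 d.fst = d.fst) :
    ∃ k : ℤ, x ^ k = φ := by
  obtain ⟨k, rfl⟩ := (mem_zpowers_iff_fixes ha φ).mpr h
  obtain ⟨l, rfl⟩ := (pow_mem_autPlusZero_iff hm ha k).mp hφ
  exact ⟨l, by rw [hx, ← zpow_natCast, ← zpow_mul]⟩

/-- The stabilizers in `autPlusZero M` of two adjacent vertices generate `autPlusZero M`. -/
theorem exists_eq_zpow_mul_zpow (hm : 3 ≤ m)
    (ha : onArcs a⁻¹.1 d = M.rotation d) (hb : onArcs b.1 d = d.symm) (hbb : b * b = 1)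
    (hx : x = a ^ (m - 1)) (hy : y = b * x * b)
    (hyH : y ∈ autPlusZero M) (hyo : orderOf y = n) {φ : M.autPlus} (hφ : φ ∈ autPlusZero M) :
    ∃ k l : ℤ, φ = y ^ l * x ^ k := by
  -- The `n` powers of `y` fix `d.snd`, so they move `d.fst` to distinct vertices of its part and
  -- hence to all of them. A power of `y` therefore corrects `φ` to fix `d.fst`.
  have hinj : Function.Injective fun ψ : Subgroup.zpowers y => (ψ.1.1 d.fst).2 := by
    rintro ⟨_, k, rfl⟩ ⟨_, l, rfl⟩ h
    apply Subtype.ext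
    refine eq_of_fixes (d := d) (Prod.ext ?_ h) ?_
    · exact ((autPlusZero M).zpow_mem hyH k d.fst).trans
        ((autPlusZero M).zpow_mem hyH l d.fst).symm
    · exact (conj_zpow_fixes_snd ha hb hbb hx hy k).trans
        (conj_zpow_fixes_snd ha hb hbb hx hy l).symm
  have hbij := (Nat.bijective_iff_injective_and_card _).mpr
    ⟨hinj, by rw [Nat.card_zpowers, hyo, Nat.card_fin]⟩
  obtain ⟨⟨_, l, rfl⟩, hl⟩ := hbij.2 (φ.1 d.fst).2
  have h1 : (y ^ l).1 d.fst = φ.1 d.fst :=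
    Prod.ext (((autPlusZero M).zpow_mem hyH l d.fst).trans (hφ d.fst).symm) hl
  have h2 : ((y ^ l)⁻¹ * φ).1 d.fst = d.fst := by
    change (y ^ l).1.symm (φ.1 d.fst) = d.fst
    rw [← h1, RelIso.symm_apply_apply]
  obtain ⟨k, hk⟩ := mem_zpowers_of_fixes_fst hm ha hx
    ((autPlusZero M).mul_mem ((autPlusZero M).inv_mem ((autPlusZero M).zpow_mem hyH l)) hφ) h2
  exact ⟨k, l, by rw [hk, mul_inv_cancel_left]⟩

end Parts

/-! ### Sylow subgroups of groups of order `p^k (p - 1)`. -/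

section Sylow

variable {G : Type*} [Group G] {p : ℕ} [Fact p.Prime]

/-- The square of `p` does not divide `p!`. -/
theorem card_map_perm_dvd (f : G →* Equiv.Perm (Fin p)) (P : Sylow p G) :
    Nat.card ((P : Subgroup G).map f) ∣ p := by
  have hpp : p.Prime := Fact.out
  obtain ⟨k, hk⟩ := IsPGroup.iff_card.mp (P.isPGroup'.map f)
  have h1 : Nat.card ((P : Subgroup G).map f) ∣ p.factorial := by
    have := Subgroup.card_subgroup_dvd_card ((P : Subgroup G).map f)
    rwa [Nat.card_eq_fintype_card (α := Equiv.Perm (Fin p)), Fintype.card_perm,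
      Fintype.card_fin] at this
  rw [hk] at h1 ⊢
  rcases Nat.lt_or_ge k 2 with h | h
  · exact pow_dvd_pow p (show k ≤ 1 by omega) |>.trans (by simp)
  · have h2 : p * p ∣ p * (p - 1).factorial := by
      rw [Nat.mul_factorial_pred hpp.ne_zero, ← sq]
      exact (pow_dvd_pow p h).trans h1
    have h3 := (hpp.dvd_factorial).mp (Nat.dvd_of_mul_dvd_mul_left hpp.pos h2)
    have := hpp.two_le
    omega

theorem perm_pow_prime_eq_one (f : G →* Equiv.Perm (Fin p)) (P : Sylow p G) {u : G} (hu : u ∈ P) :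
    f u ^ p = 1 := by
  have h1 : f u ∈ (P : Subgroup G).map f := Subgroup.mem_map_of_mem f hu
  exact orderOf_dvd_iff_pow_eq_one.mp
    ((Subgroup.orderOf_dvd_natCard _ h1).trans (card_map_perm_dvd f P))

theorem exists_perm_eq_pow (f : G →* Equiv.Perm (Fin p)) (P : Sylow p G) {u v : G} (hu : u ∈ P)
    (hv : v ∈ P) (hfu : f u ≠ 1) : ∃ s : ℕ, f v = f u ^ s := by
  have hpp : p.Prime := Fact.out
  have h1 : f u ∈ (P : Subgroup G).map f := Subgroup.mem_map_of_mem f hu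
  have h2 : f v ∈ (P : Subgroup G).map f := Subgroup.mem_map_of_mem f hv
  have hcard : Nat.card ((P : Subgroup G).map f) = p := by
    refine ((Nat.dvd_prime hpp).mp (card_map_perm_dvd f P)).resolve_left fun h => hfu ?_
    rw [Subgroup.card_eq_one] at h
    rw [h] at h1
    exact Subgroup.mem_bot.mp h1
  have h3 : (⟨f v, h2⟩ : (P : Subgroup G).map f) ∈
      Subgroup.zpowers (⟨f u, h1⟩ : (P : Subgroup G).map f) :=
    mem_zpowers_of_prime_card hcard (fun h => hfu (congrArg Subtype.val h))
  obtain ⟨s, hs⟩ := mem_powers_iff_mem_zpowers.mpr h3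
  exact ⟨s, (congrArg Subtype.val hs).symm⟩

variable [Finite G]

theorem sylow_index_dvd {k : ℕ} (hG : Nat.card G = p ^ k * (p - 1)) (P : Sylow p G) :
    (P : Subgroup G).index ∣ p - 1 := by
  have h1 : (P : Subgroup G).index ∣ p ^ k * (p - 1) := hG ▸ Subgroup.index_dvd_card _
  have h2 : ((P : Subgroup G).index).Coprime (p ^ k) := by
    have h3 : ¬ p ∣ (P : Subgroup G).index := P.not_dvd_index
    exact (((Fact.out : p.Prime).coprime_iff_not_dvd.mpr h3).symm).pow_right k
  exact h2.dvd_of_dvd_mul_left h1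

theorem sylow_normal_of_card {k : ℕ} (hp : 2 < p) (hG : Nat.card G = p ^ k * (p - 1))
    (P : Sylow p G) : (P : Subgroup G).Normal := by
  have h1 : Nat.card (Sylow p G) ∣ p - 1 := (P.card_dvd_index).trans (sylow_index_dvd hG P)
  have h2 : Nat.card (Sylow p G) ≡ 1 [MOD p] := card_sylow_modEq_one p G
  have h3 := Nat.le_of_dvd (by omega) h1
  have h4 : Nat.card (Sylow p G) = 1 := by
    rw [Nat.ModEq, Nat.mod_eq_of_lt (by omega), Nat.mod_eq_of_lt (by omega)] at h2
    exact h2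
  have : Subsingleton (Sylow p G) := (Nat.card_eq_one_iff_unique.mp h4).1
  exact P.normal_of_subsingleton

/-- In a group with a normal Sylow subgroup that has a cyclic complement, every
involution is congruent to the involution of the complement modulo the Sylow subgroup. -/
theorem mul_pow_half_mem_sylow (hp : 2 < p) (P : Sylow p G) (hP : (P : Subgroup G).Normal)
    (hind : (P : Subgroup G).index ∣ p - 1) {b γ : G} (hγ : orderOf γ = p - 1) (hbb : b * b = 1)
    (hb : b ≠ 1) : b * γ ^ ((p - 1) / 2) ∈ P := by
  have hpp : p.Prime := Fact.out
  have hodd : p % 2 = 1 := hpp.eq_two_or_odd.resolve_left (by omega)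
  have hmem : ∀ u ∈ P, ∀ k : ℕ, k.Coprime p → u ^ k = 1 → u = 1 := by
    intro u hu k hk huk
    obtain ⟨r, hr⟩ := P.isPGroup' ⟨u, hu⟩
    have hr' : u ^ p ^ r = 1 := congrArg Subtype.val hr
    have h1 := Nat.dvd_gcd (orderOf_dvd_of_pow_eq_one huk) (orderOf_dvd_of_pow_eq_one hr')
    rw [(hk.pow_right r : Nat.gcd k (p ^ r) = 1), Nat.dvd_one, orderOf_eq_one_iff] at h1
    exact h1
  let π := QuotientGroup.mk' (P : Subgroup G)
  have hπ : ∀ u, π u = 1 ↔ u ∈ (P : Subgroup G) := fun u => QuotientGroup.eq_one_iff u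
  have hcop : (p - 1).Coprime p := ((Nat.coprime_self_sub_right hpp.one_le).mpr (by simp)).symm
  -- The quotient by `P` is cyclic of even order `p - 1`, generated by `γ`, so the images of `b` and
  -- of `γ^((p-1)/2)` are both its only involution.
  have ho : orderOf (π γ) = p - 1 := by
    refine Nat.dvd_antisymm (hγ ▸ orderOf_map_dvd π γ) ?_
    rw [← hγ]
    apply orderOf_dvd_of_pow_eq_one
    refine hmem _ ((hπ _).mp (by rw [map_pow, pow_orderOf_eq_one])) (p - 1) hcop ?_
    rw [← pow_mul, mul_comm, pow_mul, ← hγ, pow_orderOf_eq_one, one_pow]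
  have hcard : Nat.card (G ⧸ (P : Subgroup G)) ≤ p - 1 :=
    Nat.le_of_dvd (by omega) hind
  have hz : Subgroup.zpowers (π γ) = ⊤ := by
    refine Subgroup.eq_top_of_le_card _ ?_
    rw [Nat.card_zpowers, ho]; exact hcard
  obtain ⟨k, hk⟩ : ∃ k : ℕ, π γ ^ k = π b :=
    mem_powers_iff_mem_zpowers.mpr (hz ▸ Subgroup.mem_top _)
  have hb1 : π b ≠ 1 := by
    intro h
    refine hb (hmem b ((hπ b).mp h) 2 ?_ (by rw [sq, hbb]))
    exact (Nat.coprime_primes Nat.prime_two hpp).mpr (by omega)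
  have h2 : p - 1 ∣ k * 2 := by
    rw [← ho]
    apply orderOf_dvd_of_pow_eq_one
    rw [pow_mul, hk, sq, ← map_mul, hbb, map_one]
  have h3 : p - 1 ∣ k + (p - 1) / 2 := by
    obtain ⟨r, hr⟩ := h2
    have hr1 : r % 2 = 1 := by
      by_contra hcon
      obtain ⟨r', rfl⟩ : ∃ r', r = 2 * r' := ⟨r / 2, by omega⟩
      apply hb1
      rw [← hk, ← orderOf_dvd_iff_pow_eq_one, ho]
      exact ⟨r', by linarith⟩
    obtain ⟨r', rfl⟩ : ∃ r', r = 2 * r' + 1 := ⟨r / 2, by omega⟩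
    obtain ⟨n, hn⟩ : ∃ n, p - 1 = 2 * n := ⟨(p - 1) / 2, by omega⟩
    rw [hn] at hr ⊢
    refine ⟨r' + 1, ?_⟩
    rw [Nat.mul_div_cancel_left _ (by norm_num)]
    linarith
  change _ ∈ (P : Subgroup G)
  rw [← hπ, map_mul, map_pow, ← hk, ← pow_add, ← orderOf_dvd_iff_pow_eq_one, ho]
  exact h3

end Sylow

/-! ### The classification of the embeddings. -/

/-- The companion matrix lemma, for conjugation on a homocyclic group of rank two. -/
theorem conj_homocyclic {G : Type*} [Group G] {p e : ℕ} (hp : p.Prime) (hp5 : 5 ≤ p) (he : 1 ≤ e)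
    {x y c : G} (hxy : Commute x y)
    (hfree : ∀ k l : ℤ, x ^ k * y ^ l = 1 → ((p ^ e : ℕ) : ℤ) ∣ k ∧ ((p ^ e : ℕ) : ℤ) ∣ l)
    (hcx : c * x * c⁻¹ = y) {α β : ℤ} (hcy : c * y * c⁻¹ = x ^ α * y ^ β)
    (hx : Commute (c ^ p) x) (hy : Commute (c ^ p) y) :
    e = 1 ∧ (p : ℤ) ∣ α + 1 ∧ (p : ℤ) ∣ β - 2 := by
  apply companion_pow_prime_eq_one hp hp5 he
  set ψ : (Fin 2 → ℤ) → G := fun v => x ^ v 0 * y ^ v 1 with hψ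
  have h1 : ∀ v, c * ψ v * c⁻¹ = ψ (Matrix.mulVec !![0, α; 1, β] v) := by
    intro v
    have hc : ∀ u : G, c * u * c⁻¹ = MulAut.conj c u := fun u => rfl
    rw [hc, hψ]
    simp only
    rw [map_mul, map_zpow, map_zpow, ← hc, ← hc, hcx, hcy, (hxy.zpow_zpow α β).mul_zpow,
      ← zpow_mul, ← zpow_mul, ← mul_assoc, (hxy.symm.zpow_zpow _ _).eq, mul_assoc, ← zpow_add]
    simp [Matrix.mulVec, dotProduct, Fin.sum_univ_two]
  have h2 : ∀ k : ℕ, ∀ v, c ^ k * ψ v * (c ^ k)⁻¹ = ψ (Matrix.mulVec (!![0, α; 1, β] ^ k) v) := by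
    intro k
    induction k with
    | zero => intro v; simp
    | succ k ih =>
      intro v
      rw [pow_succ' c, pow_succ' !![0, α; 1, β], ← Matrix.mulVec_mulVec, ← h1, ← ih]
      group
  intro i j
  have h3 := h2 p (Pi.single j 1)
  have h4 : Commute (c ^ p) (ψ (Pi.single j 1)) := (hx.zpow_right _).mul_right (hy.zpow_right _)
  rw [h4.eq, mul_inv_cancel_right] at h3
  set v := Matrix.mulVec (!![0, α; 1, β] ^ p) (Pi.single j 1) with hv
  have h5 : x ^ (v 0 - Pi.single (M := fun _ => ℤ) j 1 0) *
      y ^ (v 1 - Pi.single (M := fun _ => ℤ) j 1 1) = 1 := by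
    have h6 : x ^ v 0 * y ^ v 1 = x ^ Pi.single (M := fun _ => ℤ) j 1 0 *
      y ^ Pi.single (M := fun _ => ℤ) j 1 1 := h3.symm
    rw [sub_eq_neg_add, sub_eq_add_neg, zpow_add, zpow_add, mul_assoc, ← mul_assoc (x ^ v 0), h6,
      zpow_neg, zpow_neg, mul_assoc, mul_inv_cancel, mul_one, inv_mul_cancel]
  obtain ⟨h6, h7⟩ := hfree _ _ h5
  have h8 : ∀ i, ((!![0, α; 1, β] ^ p : Matrix (Fin 2) (Fin 2) ℤ) - 1) i j =
      v i - Pi.single (M := fun _ => ℤ) j 1 i := by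
    intro i
    rw [hv, Matrix.mulVec_single_one, Matrix.sub_apply, Matrix.one_apply, Pi.single_apply]
    rfl
  rw [h8]
  fin_cases i
  · exact h6
  · exact h7

open OrientedEmbedding in
/-- The automorphism group of a regular embedding whose part-preserving subgroup is abelian and
whose Sylow `p`-subgroups have the smallest possible exponent. -/
theorem eq_one_and_exists_isomorphic_mapTwo {p : ℕ} [Fact p.Prime] (hp5 : 5 ≤ p) {t : (ZMod p)ˣ}
    (ht : ∀ u : (ZMod p)ˣ, u ∈ Subgroup.zpowers t) {e : ℕ} (he : 1 ≤ e)
    (M : OrientedEmbedding (SimpleGraph.completeEquipartiteGraph p (p ^ e)))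
    (hM : M.IsOrientablyRegular)
    (hH : ∀ x ∈ autPlusZero M, ∀ y ∈ autPlusZero M, x * y = y * x)
    (P : Sylow p M.autPlus) (hP : Monoid.exponent P = p ^ e) :
    e = 1 ∧ ∃ j : (ZMod (p - 1))ˣ, M.toArcMap.Isomorphic (mapTwo p t j) := by
  have hpp : p.Prime := Fact.out
  have : NeZero p := ⟨hpp.ne_zero⟩
  have : NeZero (p ^ e) := ⟨pow_ne_zero _ hpp.ne_zero⟩
  let i₀ : Fin p := ⟨0, by omega⟩
  let i₁ : Fin p := ⟨1, by omega⟩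
  let d : (SimpleGraph.completeEquipartiteGraph p (p ^ e)).Dart :=
    ⟨((i₀, 0), (i₁, 0)), by
      rw [SimpleGraph.completeEquipartiteGraph_adj]; exact fun h => by simp [i₀, i₁] at h⟩
  obtain ⟨a', ha'⟩ := (hM.bijective d).2 (M.rotation d)
  obtain ⟨b, hb⟩ := (hM.bijective d).2 d.symm
  change onArcs a'.1 d = M.rotation d at ha'
  change onArcs b.1 d = d.symm at hb
  obtain ⟨a, rfl⟩ : ∃ a : M.autPlus, a' = a⁻¹ := ⟨a'⁻¹, (inv_inv a').symm⟩
  have hbb : b * b = 1 := by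
    refine M.autPlus_ext (d := d) ?_
    change onArcs b.1 (onArcs b.1 d) = d
    rw [hb, onArcs_symm, hb, SimpleGraph.Dart.symm_symm]
  have hbinv : b⁻¹ = b := inv_eq_of_mul_eq_one_right hbb
  have hb1 : b ≠ 1 := by
    rintro rfl
    exact SimpleGraph.Dart.symm_ne d hb.symm
  have hiso : M.toArcMap.Isomorphic (algebraicMap a b) :=
    toArcMap_isomorphic_algebraicMap hM ha' (by rw [hbinv]; exact hb)
  have hcard : Nat.card M.autPlus = p ^ (2 * e + 1) * (p - 1) := by
    rw [card_autPlus hM d, card_dart_completeEquipartiteGraph]; ring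
  have hPn := sylow_normal_of_card (by omega) hcard P
  have hao : orderOf a = (p - 1) * p ^ e := orderOf_rotation hM ha'
  set x := a ^ (p - 1) with hx
  set y := b * x * b with hy
  set γ := a ^ p ^ e with hγ
  set c := b * γ ^ ((p - 1) / 2) with hc
  have hγo : orderOf γ = p - 1 := by
    rw [hγ, orderOf_pow, hao, Nat.gcd_eq_right (dvd_mul_left _ _), Nat.mul_div_cancel _
      (pow_pos hpp.pos e)]
  have hyx : y = b * x * b⁻¹ := by rw [hbinv]
  have hxo : orderOf x = p ^ e := orderOf_pow_pred (by omega) hM ha'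
  have hyo : orderOf y = p ^ e := by
    rw [hyx]
    exact ((MulAut.conj b).orderOf_eq x).trans hxo
  have hHn : (autPlusZero M).Normal := autPlusZero_normal
  have hxH : x ∈ autPlusZero M := by
    have := (pow_mem_autPlusZero_iff (by omega) ha' ((p - 1 : ℕ) : ℤ)).mpr dvd_rfl
    rwa [zpow_natCast] at this
  have hyH : y ∈ autPlusZero M := hyx ▸ hHn.conj_mem x hxH b
  have hxy : Commute x y := hH x hxH y hyH
  have hfree : ∀ k l : ℤ, x ^ k * y ^ l = 1 →
      ((p ^ e : ℕ) : ℤ) ∣ k ∧ ((p ^ e : ℕ) : ℤ) ∣ l := fun k l h =>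
    zpow_mul_zpow_eq_one ha' hb hbb hx hy hxo hyo h
  have hspan : ∀ φ ∈ autPlusZero M, ∃ k l : ℤ, φ = x ^ k * y ^ l := by
    intro φ hφ
    obtain ⟨k, l, h⟩ := exists_eq_zpow_mul_zpow (by omega) ha' hb hbb hx hy hyH hyo hφ
    exact ⟨k, l, by rw [h, (hxy.zpow_zpow k l).eq]⟩
  have hcP : c ∈ P := mul_pow_half_mem_sylow (by omega) P hPn (sylow_index_dvd hcard P) hγo hbb hb1
  have hιx : γ ^ ((p - 1) / 2) * x = x * γ ^ ((p - 1) / 2) :=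
    (((Commute.refl a).pow_pow (p ^ e) (p - 1)).pow_left _).eq
  have hcx : c * x * c⁻¹ = y := by
    rw [hc, mul_assoc b, hιx, hyx]; group
  have hcH : c ^ p ∈ autPlusZero M := by
    rw [← ker_autPartPerm, MonoidHom.mem_ker, map_pow]
    exact perm_pow_prime_eq_one _ P hcP
  -- If `c` lay in the abelian group `H`, it would centralize `x`, so `y = x`, against independence.
  have hc1 : autPartPerm M c ≠ 1 := by
    intro h
    have h1 : c ∈ autPlusZero M := by rwa [← ker_autPartPerm, MonoidHom.mem_ker]
    have h2 := hcx
    rw [hH c h1 x hxH, mul_inv_cancel_right] at h2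
    have h3 := (hfree 1 (-1) (by rw [← h2]; simp)).1
    have h4 := Int.le_of_dvd one_pos h3
    have h5 : 1 < p ^ e := Nat.one_lt_pow (by omega) hpp.one_lt
    omega
  obtain ⟨α, β, hαβ⟩ := hspan _ (hHn.conj_mem y hyH c)
  -- Since `c^p` lies in the abelian group `H`, it centralizes `x` and `y`.
  obtain ⟨rfl, hα, hβ⟩ := conj_homocyclic hpp hp5 he hxy hfree hcx hαβ (hH _ hcH x hxH)
    (hH _ hcH y hyH)
  refine ⟨rfl, ?_⟩
  replace hao : orderOf a = (p - 1) * p := hao.trans (congrArg _ (pow_one p))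
  replace hxo : orderOf x = p := hxo.trans (pow_one p)
  replace hyo : orderOf y = p := hyo.trans (pow_one p)
  replace hP : Monoid.exponent P = p := hP.trans (pow_one p)
  have hcp : c ^ p = 1 := by
    have h := Monoid.pow_exponent_eq_one (⟨c, hcP⟩ : (P : Subgroup M.autPlus))
    rw [hP] at h
    exact congrArg Subtype.val h
  have hxp : x ^ p = 1 := orderOf_dvd_iff_pow_eq_one.mp hxo.dvd
  have hyp : y ^ p = 1 := orderOf_dvd_iff_pow_eq_one.mp hyo.dvd
  have hcy : c * y * c⁻¹ = x⁻¹ * y ^ 2 := by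
    rw [hαβ, zpow_eq_zpow_of_dvd_sub (k := -1) hxp (by simpa using hα),
      zpow_eq_zpow_of_dvd_sub (k := 2) hyp hβ, zpow_neg_one]
    norm_cast
  have hconj : ∃ s : ℕ, ∃ m n : ℤ, γ⁻¹ * c * γ = c ^ s * (x ^ m * y ^ n) := by
    have h1 : γ⁻¹ * c * γ ∈ P := by
      have := hPn.conj_mem c hcP γ⁻¹
      rwa [inv_inv] at this
    -- The Sylow subgroup acts on the parts as a group of order `p` generated by the image of `c`,
    -- so the conjugate of `c` agrees with a power of `c` modulo `H`.
    obtain ⟨s, hs⟩ := exists_perm_eq_pow (autPartPerm M) P hcP h1 hc1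
    have h2 : (c ^ s)⁻¹ * (γ⁻¹ * c * γ) ∈ autPlusZero M := by
      rw [← ker_autPartPerm, MonoidHom.mem_ker, map_mul, map_inv, map_pow, hs, inv_mul_cancel]
    obtain ⟨m, n, h⟩ := hspan _ h2
    exact ⟨s, m, n, by rw [← h, mul_inv_cancel_left]⟩
  have hγ' : γ = a ^ p := hγ.trans (congrArg (a ^ ·) (pow_one p))
  rw [hγ'] at hconj
  obtain ⟨j, Θ, hΘa, hΘb⟩ := exists_mulEquiv_groupTwo hp5 ht (a := a) (b := b) (x := x) (y := y)
    (c := c) (by rw [hcard]; ring) (OrientedEmbedding.closure_eq_top ha' hb) hbb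
    (by rw [hao, mul_comm]) hx hy (by rw [hc, hγ']) hxy (by simpa using hfree) hcp hcy hconj
    (fun k hk => pow_eq_one_of_commute ha' hb k hk)
  refine ⟨j, hiso.trans ?_⟩
  rw [← hΘa, ← hΘb]
  exact (algebraicMap_isomorphic_map Θ _ _).symm

theorem theorem3p5 (p : ℕ) (hp : p.Prime) (hp5 : 5 ≤ p)
    (t : (ZMod p)ˣ) (ht : ∀ u : (ZMod p)ˣ, u ∈ Subgroup.zpowers t) :
    (∀ e : ℕ, 1 ≤ e →
      ∀ M : OrientedEmbedding (SimpleGraph.completeEquipartiteGraph p (p ^ e)),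
        M.IsOrientablyRegular →
        (∀ x ∈ autPlusZero M, ∀ y ∈ autPlusZero M, x * y = y * x) →
        ∀ P : Sylow p M.autPlus, Monoid.exponent P = p ^ e →
          e = 1 ∧ ∃! j : (ZMod (p - 1))ˣ, M.toArcMap.Isomorphic (mapTwo p t j)) ∧
    (∀ j₁ j₂ : (ZMod (p - 1))ˣ, (mapTwo p t j₁).Isomorphic (mapTwo p t j₂) → j₁ = j₂) ∧
    (∀ j : (ZMod (p - 1))ˣ,
      (∃ E : OrientedEmbedding (SimpleGraph.completeEquipartiteGraph p p),
        E.IsOrientablyRegular ∧ E.toArcMap.Isomorphic (mapTwo p t j)) ∧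
      (mapTwo p t j).Chiral ∧
      (p % 4 = 1 → (mapTwo p t j).HasType (p * (p - 1)) (p * (p - 1))) ∧
      (p % 4 = 3 → (mapTwo p t j).HasType (p * (p - 1) / 2) (p * (p - 1)))) := by
  have := Fact.mk hp
  refine ⟨fun e he M hM hH P hP => ?_, fun j₁ j₂ h => mapTwo_multiplier_eq hp5 ht h, fun j =>
    ⟨exists_embedding_isomorphic_mapTwo hp5 ht j, mapTwo_chiral hp5 ht j,
      mapTwo_hasType_of_mod_four_eq_one hp5 ht j, mapTwo_hasType_of_mod_four_eq_three hp5 ht j⟩⟩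
  obtain ⟨he1, j, hj⟩ := eq_one_and_exists_isomorphic_mapTwo hp5 ht he M hM hH P hP
  exact ⟨he1, j, hj, fun j' hj' => mapTwo_multiplier_eq hp5 ht (hj'.symm.trans hj)⟩
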